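/- **Setting.** Let $Y$ be the set of planar binary rooted trees, $|t|$ the number of internal vertices of $t$, $\circ$ the tree with $|\circ|=0$, $\bullet$ the tree with $|\bullet|=1$, and $\overline Y=Y\setminus\{\circ\}$. Let $t/s$ (resp. $t\backslash s$) be the tree obtained by grafting the root of $t$ on the left-most leaf of $s$ (resp. the root of $s$ on the right-most leaf of $t$), and $V(t)=\bullet\backslash t$. Every $t\ne\circ$ is uniquely $t=t^l/V(t^r)$. For $t\in Y$, $n=|t|$ and $s_1,\dots,s_n\in\overline Y$, let $\mu_t(s_1,\dots,s_n)$ be the tree obtained by replacing the $n$ vertices of $t$, read from left to right, by $s_1,\dots,s_n$, i.e. $\mu_\circ()=\circ$ and $\mu_{t}(s_1,\dots,s_n)=\mu_{t^l}(s_1,\dots,s_{k})/s_{k+1}\backslash\mu_{t^r}(s_{k+2},\dots,s_n)$ with $k=|t^l|$. For a commutative unital $\mathbb Q$-algebra $A$ let $A[[Y]]$ be the set of series $\sum_{t\in Y}f_tx^t$, with the products $/$ and $\backslash$ extending $x^t/x^s=x^{t/s}$ and $x^t\backslash x^s=x^{t\backslash s}$. Series over $\overline Y$ are composed by $\varphi\circ\psi=\sum_{t\in\overline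 Y}\sum_{s_1,\dots,s_{|t|}\in\overline Y}\varphi_t\psi_{s_1}\cdots\psi_{s_{|t|}}\,x^{\mu_t(s_1,\dots,s_{|t|})}$. Put $$G^\rho_Y(A)=\{f/x^{\bullet}: f\in A[[Y]],\ f_\circ=1\},\qquad G^\alpha(A)=\{(x^\circ-x^\bullet\backslash f)^{-1}/x^\bullet:\ f\in A[[Y]]\},$$ where the inverse is taken for the product $/$. Let $\mathcal H^{\alpha,nc}=\mathbb QY$ be the algebra of all trees with product $/$ and unit $\circ$, graded by $|t|$. Let $\Delta^{\alpha}:\mathbb QY\to\mathbb QY\otimes\mathbb QY$ be the algebra morphism defined recursively by $$\Delta^\alpha(V(t))=1\otimes V(t)+\delta^\alpha(V(t)),\qquad \delta^\alpha(V(\circ))=V(\circ)\otimes1,$$ $$\delta^\alpha(V(t))=(V\otimes\mathrm{Id})\big[\Delta^\alpha(t^l)/\delta^\alpha(V(t^r))\big]\quad\text{for } t=t^l/V(t^r),$$ and let $\varepsilon(V(t))=0$. Let $\mathcal H^\alpha=\mathbb Q[V(t),\,t\in Y]$ with the algebra morphisms $\Delta^\alpha,\varepsilon$ given on the generators by the images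 of the above under the projection $\mathbb QY\to\mathcal H^\alpha$, $V(t_1)/\cdots/V(t_n)\mapsto V(t_1)\cdots V(t_n)$. Let $\mathcal H^\rho_Y=\mathbb Q[\overline Y]$ (with $\circ=1$), with counit zero on $\overline Y$ and coproduct the algebra morphism $$\Delta^\rho_Y(u)=1\otimes u+\sum t\otimes s_1\cdots s_{|t|}s_{|t|+1},$$ the sum over $t\in\overline Y$, $s_1,\dots,s_{|t|+1}\in Y$ with $u=\mu_t(s_1/\bullet,\dots,s_{|t|}/\bullet)/s_{|t|+1}$. **Theorem.** 1. $\mathcal H^\alpha$, with $\Delta^\alpha$ and $\varepsilon$, is a connected graded Hopf algebra (graded by the order of trees). 2. $G^\alpha(A)$ is a group under composition with unit $x^\bullet$, functorially in $A$, and this group functor is represented by $\mathcal H^\alpha$: $\chi\mapsto\sum_{t\in Y}\chi(t)\,x^{t/\bullet}$ (where $t=V(t_1)/\cdots/V(t_n)$ is seen in $\mathcal H^\alpha$) is a bijection $\mathrm{Hom}_{Alg}(\mathcal H^\alpha,A)\to G^\alpha(A)$, natural in $A$, carrying the convolution product $(\chi,\chi')\mapsto m_A(\chi\otimes\chi')\Delta^\alpha$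 to composition and the trivial character to the unit. 3. $\mathcal H^\rho_Y$ is a Hopf algebra which represents, in the same way, the group functor $G^\rho_Y$; one has $G^\alpha(A)\subseteq G^\rho_Y(A)$, and the algebra morphism $R:\mathcal H^\rho_Y\to\mathcal H^\alpha$, $u=V(u_1)/\cdots/V(u_n)\mapsto V(u_1)\cdots V(u_n)$, dual to this inclusion, is a surjective morphism of Hopf algebras: $(R\otimes R)\Delta^\rho_Y=\Delta^\alpha R$ and $\varepsilon R=\varepsilon$. 4. $\mathcal H^{\alpha,nc}$ is the free associative algebra on the $V(t)$, $t\in Y$; with $\Delta^\alpha$ and $\varepsilon$ it is a connected graded Hopf algebra, and its abelian quotient (by the two-sided ideal generated by the commutators) is the Hopf algebra $\mathcal H^\alpha$. 5. In $\mathcal H^{\alpha,nc}$ and in $\mathcal H^\alpha$, for every $u\in Y$, $$\Delta^\alpha(V(u))=1\otimes V(u)+\sum_{\substack{t\in Y,\ s_1,\dots,s_{|t|}\in Y\\ u=\mu_t(s_1/\bullet,\dots,s_{|t|}/\bullet)}}V(t)\otimes s_1/\cdots/s_{|t|}.$$ -/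

import Mathlib

universe u

open scoped TensorProduct

namespace QEDCharge

/-! ### Planar binary rooted trees, the over and under products -/

/-- Planar binary rooted trees. `nil` is the root tree (no internal vertex), and `node () l r` is
the tree whose root vertex carries `l` on its left leaf and `r` on its right leaf.
The order `|t|` of a tree is `t.numNodes`, its number of internal vertices. -/
abbrev Y : Type := BinaryTree Unit

/-- The vertex tree, the unique tree of order one. -/
def vtx : Y := .node () .nil .nil

/-- `graftOver t s` is `t / s`: the root of `t` is grafted on the left-most leaf of `s`. -/
def graftOver (t : Y) : Y → Y
  | .nil => t
  | .node _ l r => .node () (graftOver t l) r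

/-- `graftUnder t s` is `t \ s`: the root of `s` is grafted on the right-most leaf of `t`. -/
def graftUnder : Y → Y → Y
  | .nil, s => s
  | .node _ l r, s => .node () l (graftUnder r s)

/-- `V t = vtx \ t`, the tree whose root vertex has nothing on its left and `t` on its right. -/
def V (t : Y) : Y := graftUnder vtx t

theorem nil_graftOver (t : Y) : graftOver .nil t = t := by
  induction t with
  | nil => rfl
  | node a l r hl _ => simp [graftOver, hl]

theorem graftOver_assoc (a b c : Y) :
    graftOver (graftOver a b) c = graftOver a (graftOver b c) := by
  induction c with
  | nil => rfl
  | node _ l r hl _ => simp [graftOver, hl]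

theorem numNodes_graftOver (a b : Y) : (graftOver a b).numNodes = a.numNodes + b.numNodes := by
  induction b with
  | nil => rfl
  | node _ l r hl _ => simp [graftOver, hl]; omega

theorem numNodes_graftUnder (a b : Y) : (graftUnder a b).numNodes = a.numNodes + b.numNodes := by
  induction a with
  | nil => simp [graftUnder]
  | node _ l r _ hr => simp [graftUnder, hr]; omega

/-- The monoid of trees with the over product: `t * s = t / s` and `1 = nil`. -/
instance : Monoid Y where
  mul := graftOver
  one := .nil
  mul_assoc := graftOver_assoc
  one_mul := nil_graftOver
  mul_one _ := rfl

theorem mul_def (a b : Y) : a * b = graftOver a b := rfl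

theorem one_def : (1 : Y) = .nil := rfl

/-- The tree product `μ_t(s₁, …, s_n)`, where `n = |t|`: each internal vertex of `t` is replaced by
one of the trees `s_i`. The vertices of `node () l r = l / vtx \ r` are read from left to right:
first those of `l`, then the root vertex, then those of `r`. It is used for lists of length `|t|`
of trees different from `nil`, for which `(l / s) \ r = l / (s \ r)`. -/
def treeProd : Y → List Y → Y
  | .nil, _ => .nil
  | .node _ l r, L =>
      graftUnder (graftOver (treeProd l (L.take l.numNodes)) (L.getD l.numNodes .nil))
        (treeProd r (L.drop (l.numNodes + 1)))

theorem numNodes_treeProd (t : Y) (L : List Y) (h : L.length = t.numNodes) :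
    (treeProd t L).numNodes = (L.map BinaryTree.numNodes).sum := by
  induction t generalizing L with
  | nil =>
    have : L = [] := List.length_eq_zero_iff.mp (by simpa using h)
    subst this
    simp [treeProd]
  | node _ l r hl hr =>
    simp only [BinaryTree.numNodes] at h
    have hlt : l.numNodes < L.length := by omega
    have e : L = L.take l.numNodes ++ L[l.numNodes] :: L.drop (l.numNodes + 1) := by
      rw [List.cons_getElem_drop_succ, List.take_append_drop]
    have h1 := hl (L.take l.numNodes) (by simp; omega)
    have h2 := hr (L.drop (l.numNodes + 1)) (by simp; omega)
    have h3 : L.getD l.numNodes .nil = L[l.numNodes] := by simp [hlt]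
    rw [treeProd, numNodes_graftUnder, numNodes_graftOver, h1, h2, h3]
    conv_rhs => rw [e]
    simp only [List.map_append, List.map_cons, List.sum_append, List.sum_cons]
    omega

/-! ### Finite index sets of the sums over trees -/

/-- The trees of order at most `n`. -/
def treesLE (n : ℕ) : Finset Y := (Finset.range (n + 1)).biUnion BinaryTree.treesOfNumNodesEq

theorem mem_treesLE {n : ℕ} {t : Y} : t ∈ treesLE n ↔ t.numNodes ≤ n := by
  simp [treesLE, BinaryTree.mem_treesOfNumNodesEq]

/-- All pairs `(p, q)` of trees with `p / q = u`. -/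
def overPairs (u : Y) : Finset (Y × Y) :=
  (treesLE u.numNodes ×ˢ treesLE u.numNodes).filter fun p => graftOver p.1 p.2 = u

theorem mem_overPairs {u : Y} {p : Y × Y} : p ∈ overPairs u ↔ graftOver p.1 p.2 = u := by
  simp only [overPairs, Finset.mem_filter, Finset.mem_product, mem_treesLE,
    and_iff_right_iff_imp]
  rintro rfl
  rw [numNodes_graftOver]
  omega

/-- All pairs `(p, q)` of trees with `p \ q = u`. -/
def underPairs (u : Y) : Finset (Y × Y) :=
  (treesLE u.numNodes ×ˢ treesLE u.numNodes).filter fun p => graftUnder p.1 p.2 = u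

theorem mem_underPairs {u : Y} {p : Y × Y} : p ∈ underPairs u ↔ graftUnder p.1 p.2 = u := by
  simp only [underPairs, Finset.mem_filter, Finset.mem_product, mem_treesLE,
    and_iff_right_iff_imp]
  rintro rfl
  rw [numNodes_graftUnder]
  omega

theorem finite_lists (n : ℕ) :
    {L : List Y | L.length ≤ n ∧ ∀ x ∈ L, x.numNodes ≤ n}.Finite := by
  refine ((List.finite_length_le {t : Y // t ∈ treesLE n} n).image
    (List.map Subtype.val)).subset ?_
  rintro L ⟨h1, h2⟩
  refine ⟨L.attach.map fun x => ⟨x.1, mem_treesLE.2 (h2 x.1 x.2)⟩, by simpa using h1, ?_⟩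
  simp [List.map_map, Function.comp_def]

theorem finite_pairs (n : ℕ) :
    {p : Y × List Y | p.1.numNodes ≤ n ∧ p.2.length ≤ n ∧ ∀ x ∈ p.2, x.numNodes ≤ n}.Finite := by
  refine ((treesLE n).finite_toSet.prod (finite_lists n)).subset ?_
  rintro ⟨t, L⟩ ⟨h1, h2⟩
  exact ⟨mem_treesLE.2 h1, h2⟩

theorem le_sum_numNodes {L : List Y} {x : Y} (hx : x ∈ L) :
    x.numNodes ≤ (L.map BinaryTree.numNodes).sum :=
  List.single_le_sum (by simp) _ (List.mem_map_of_mem hx)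

theorem length_le_sum_numNodes {L : List Y} (h : ∀ x ∈ L, x ≠ .nil) :
    L.length ≤ (L.map BinaryTree.numNodes).sum := by
  induction L with
  | nil => simp
  | cons a L ih =>
    have h1 := ih fun x hx => h x (by simp [hx])
    have h2 : 1 ≤ a.numNodes := by
      cases a with
      | nil => exact absurd rfl (h .nil (by simp))
      | node => simp
    simp only [List.length_cons, List.map_cons, List.sum_cons]
    omega

theorem decomp_finite (u : Y) :
    {p : Y × List Y | p.2.length = p.1.numNodes ∧ (∀ s ∈ p.2, s ≠ .nil) ∧
      treeProd p.1 p.2 = u}.Finite := by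
  refine (finite_pairs u.numNodes).subset ?_
  rintro ⟨t, L⟩ ⟨h1, h2, rfl⟩
  have h3 := length_le_sum_numNodes h2
  rw [← numNodes_treeProd t L h1] at h3
  refine ⟨h1 ▸ h3, h3, fun x hx => ?_⟩
  rw [numNodes_treeProd t L h1]
  exact le_sum_numNodes hx

/-- All `(t; s₁, …, s_{|t|})` with `s_i ≠ nil` and `μ_t(s₁, …, s_{|t|}) = u`. -/
noncomputable def decomp (u : Y) : Finset (Y × List Y) := (decomp_finite u).toFinset

theorem rhoDecomp_finite (u : Y) :
    {p : Y × List Y × Y | p.1 ≠ .nil ∧ p.2.1.length = p.1.numNodes ∧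
      graftOver (treeProd p.1 (p.2.1.map fun s => graftOver s vtx)) p.2.2 = u}.Finite := by
  have hf := (finite_pairs u.numNodes).prod (treesLE u.numNodes).finite_toSet
  refine (hf.image fun x => (x.1.1, x.1.2, x.2)).subset ?_
  rintro ⟨t, L, q⟩ ⟨_, h1, h2⟩
  dsimp only at h1 h2
  have h3 := congrArg BinaryTree.numNodes h2
  rw [numNodes_graftOver, numNodes_treeProd _ _ (by simpa using h1)] at h3
  have h4 : ∀ s ∈ L.map (fun s => graftOver s vtx), s ≠ .nil := by
    simp [vtx, graftOver]
  have h5 := length_le_sum_numNodes h4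
  rw [List.length_map] at h5
  refine ⟨((t, L), q), ⟨⟨?_, ?_, fun x hx => ?_⟩, ?_⟩, rfl⟩
  · dsimp only; omega
  · dsimp only; omega
  · change x ∈ L at hx
    have h6 := le_sum_numNodes (List.mem_map_of_mem (f := fun s => graftOver s vtx) hx)
    rw [numNodes_graftOver] at h6
    omega
  · exact mem_treesLE.2 (by dsimp only; omega)

/-- All `(t; s₁, …, s_{|t|}; s_{|t|+1})` with `t ≠ nil`, `s_i` arbitrary trees and
`u = μ_t(s₁ / vtx, …, s_{|t|} / vtx) / s_{|t|+1}`. -/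
noncomputable def rhoDecomp (u : Y) : Finset (Y × List Y × Y) := (rhoDecomp_finite u).toFinset

theorem alphaDecomp_finite (u : Y) :
    {p : Y × List Y | p.2.length = p.1.numNodes ∧
      treeProd p.1 (p.2.map fun s => graftOver s vtx) = u}.Finite := by
  refine (((rhoDecomp_finite u).image fun x => (x.1, x.2.1)).union
    (Set.finite_singleton (.nil, []))).subset ?_
  rintro ⟨t, L⟩ ⟨h1, h2⟩
  dsimp only at h1 h2
  by_cases h : t = .nil
  · subst h
    exact Or.inr (by simpa using h1)
  · exact Or.inl ⟨(t, L, .nil), ⟨h, h1, h2⟩, rfl⟩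

/-- All `(t; s₁, …, s_{|t|})` with `s_i` arbitrary trees and
`u = μ_t(s₁ / vtx, …, s_{|t|} / vtx)`. For `u = nil` the only element is `(nil; )`, and for
`u ≠ nil` every element has `t ≠ nil`. -/
noncomputable def alphaDecomp (u : Y) : Finset (Y × List Y) := (alphaDecomp_finite u).toFinset

/-! ### Tree-expanded series

A series `∑ f_t x^t` in `A[[Y]]` is the function `t ↦ f_t`; the series in `A[[Ȳ]]`, over the trees
different from `nil`, are those with `f_nil = 0`. -/

section Series

variable {A : Type u} [CommRing A]

/-- The series `x^t`. -/
def xpow (t : Y) : Y → A := fun s => if s = t then 1 else 0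

/-- The over product of series. -/
def overMul (f g : Y → A) : Y → A := fun u => ∑ p ∈ overPairs u, f p.1 * g p.2

/-- The under product of series. -/
def underMul (f g : Y → A) : Y → A := fun u => ∑ p ∈ underPairs u, f p.1 * g p.2

/-- The composition `φ ∘ ψ = ∑ φ_t ψ_{s₁} ⋯ ψ_{s_{|t|}} x^{μ_t(s₁, …, s_{|t|})}`, where
`s₁, …, s_{|t|}` run over the trees different from `nil`. On `A[[Ȳ]]` this is the composition of
tree-expanded diffeomorphisms. -/
noncomputable def comp (φ ψ : Y → A) : Y → A :=
  fun u => ∑ p ∈ decomp u, φ p.1 * (p.2.map ψ).prod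

end Series

/-- The set of the series `ρ_f = f / x^vtx`, where `f ∈ A[[Y]]` has constant term `1`. -/
def Grho (A : Type u) [CommRing A] [Algebra ℚ A] : Set (Y → A) :=
  {φ | ∃ f : Y → A, f .nil = 1 ∧ φ = overMul f (xpow vtx)}

/-- The set of the series `α_f = (x^nil - x^vtx \ f)⁻¹ / x^vtx`, for `f ∈ A[[Y]]`. The inverse,
here called `g`, is the one for the over product of series. -/
def Galpha (A : Type u) [CommRing A] [Algebra ℚ A] : Set (Y → A) :=
  {φ | ∃ f g : Y → A,
    overMul (xpow .nil - underMul (xpow vtx) f) g = xpow .nil ∧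
    overMul g (xpow .nil - underMul (xpow vtx) f) = xpow .nil ∧
    φ = overMul g (xpow vtx)}

/-- The sets `G A` of tree-expanded series form groups under composition, with unit `x^vtx`,
functorially in the commutative `ℚ`-algebra `A`. -/
structure IsGroupFunctor
    (G : ∀ (A : Type u) [CommRing A] [Algebra ℚ A], Set (Y → A)) : Prop where
  group : ∀ (A : Type u) [CommRing A] [Algebra ℚ A],
    ∃ _ : Group (G A), (∀ φ ψ : G A, ((φ * ψ : G A) : Y → A) = comp (φ : Y → A) (ψ : Y → A)) ∧
      ((1 : G A) : Y → A) = xpow vtx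
  map_mem : ∀ (A B : Type u) [CommRing A] [Algebra ℚ A] [CommRing B] [Algebra ℚ B]
    (h : A →ₐ[ℚ] B), ∀ φ ∈ G A, (fun t => h (φ t)) ∈ G B
  map_comp : ∀ (A B : Type u) [CommRing A] [Algebra ℚ A] [CommRing B] [Algebra ℚ B]
    (h : A →ₐ[ℚ] B), ∀ φ ∈ G A, ∀ ψ ∈ G A,
      (fun t => h (comp φ ψ t)) = comp (fun t => h (φ t)) (fun t => h (ψ t))

/-! ### Hopf algebras and the groups they represent -/

/-- The algebra morphisms `Δ` and `ε` are the coproduct and the counit of a Hopf algebra structure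
(in the sense of Mathlib) on the algebra `H`. -/
def IsHopf {H : Type} [Ring H] [Algebra ℚ H] (Δ : H →ₐ[ℚ] H ⊗[ℚ] H) (ε : H →ₐ[ℚ] ℚ) : Prop :=
  ∃ h_coassoc h_rTensor h_lTensor, ∃ hopf : HopfAlgebra ℚ H,
    hopf.toBialgebra = Bialgebra.ofAlgHom Δ ε h_coassoc h_rTensor h_lTensor

/-- `(H, Δ, ε)` is graded by the subspaces `gr n`, and connected: `gr 0 = ℚ ⬝ 1`. -/
structure IsGradedConnected {H : Type} [Ring H] [Algebra ℚ H]
    (Δ : H →ₐ[ℚ] H ⊗[ℚ] H) (ε : H →ₐ[ℚ] ℚ) (gr : ℕ → Submodule ℚ H) : Prop where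
  decomposition : DirectSum.IsInternal gr
  mul_mem : ∀ m n, ∀ x ∈ gr m, ∀ y ∈ gr n, x * y ∈ gr (m + n)
  comul_mem : ∀ n, ∀ x ∈ gr n, Δ x ∈ ⨆ p : {p : ℕ × ℕ // p.1 + p.2 = n},
    LinearMap.range (TensorProduct.map (gr p.1.1).subtype (gr p.1.2).subtype)
  counit_eq_zero : ∀ n, n ≠ 0 → ∀ x ∈ gr n, ε x = 0
  connected : gr 0 = Submodule.span ℚ {1}

/-- The subspaces spanned by the images under `c` of the trees of order `n`. -/
def orderGrading {H : Type} [Ring H] [Algebra ℚ H] (c : Y → H) (n : ℕ) : Submodule ℚ H :=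
  Submodule.span ℚ (c '' {t | t.numNodes = n})

section Points

variable {H : Type} [Ring H] [Algebra ℚ H] {A : Type u} [CommRing A] [Algebra ℚ A]

/-- The convolution product of two `A`-valued characters of `H`. -/
noncomputable def convMul (Δ : H →ₐ[ℚ] H ⊗[ℚ] H) (χ ψ : H →ₐ[ℚ] A) : H →ₐ[ℚ] A :=
  (Algebra.TensorProduct.lift χ ψ fun _ _ => Commute.all _ _).comp Δ

/-- The series `∑_{t ∈ Y} χ(c t) x^{t / vtx}` attached to a character `χ`. -/
def pointSeries (c : Y → H) (χ : H →ₐ[ℚ] A) : Y → A :=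
  overMul (fun t => χ (c t)) (xpow vtx)

end Points

/-- The group functor `G` is represented by `(H, Δ, ε)` through the coordinate functions `c`: for
every commutative `ℚ`-algebra `A`, the map sending a character `χ : H → A` to
`∑ χ(c t) x^{t / vtx}` is a bijection from `Hom_Alg(H, A)` onto `G A`, natural in `A`, which carries
the convolution product to the composition and the trivial character to the unit. -/
structure IsRepresentedBy {H : Type} [Ring H] [Algebra ℚ H]
    (Δ : H →ₐ[ℚ] H ⊗[ℚ] H) (ε : H →ₐ[ℚ] ℚ) (c : Y → H)
    (G : ∀ (A : Type u) [CommRing A] [Algebra ℚ A], Set (Y → A)) : Prop where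
  bijOn : ∀ (A : Type u) [CommRing A] [Algebra ℚ A],
    Set.BijOn (fun χ : H →ₐ[ℚ] A => pointSeries c χ) Set.univ (G A)
  map_conv : ∀ (A : Type u) [CommRing A] [Algebra ℚ A] (χ ψ : H →ₐ[ℚ] A),
    pointSeries c (convMul Δ χ ψ) = comp (pointSeries c χ) (pointSeries c ψ)
  map_counit : ∀ (A : Type u) [CommRing A] [Algebra ℚ A],
    pointSeries c ((Algebra.ofId ℚ A).comp ε) = xpow vtx
  natural : ∀ (A B : Type u) [CommRing A] [Algebra ℚ A] [CommRing B] [Algebra ℚ B]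
    (h : A →ₐ[ℚ] B) (χ : H →ₐ[ℚ] A),
    pointSeries c (h.comp χ) = fun t => h (pointSeries c χ t)

/-! ### The non-commutative charge algebra: the recursive coproduct -/

/-- The algebra `ℚY` of all trees with the over product. -/
abbrev Hnc : Type := MonoidAlgebra ℚ Y

/-- A tree as an element of `ℚY`. -/
noncomputable def ncTree (t : Y) : Hnc := MonoidAlgebra.single t 1

/-- The linear extension of `V` to `ℚY`. -/
noncomputable def linV : Hnc →ₗ[ℚ] Hnc := MonoidAlgebra.mapDomainLinearMap ℚ ℚ V

/-- The pair `(Δ(t), δ(V(t)))`, defined by recursion. The tree `node () l r` is `l / V(r)`, so that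
`Δ(l / V(r)) = Δ(l) / Δ(V(r))` with `Δ(V(r)) = 1 ⊗ V(r) + δ(V(r))`, and
`δ(V(l / V(r))) = (V ⊗ Id)[Δ(l) / δ(V(r))]`. The initial values are `Δ(nil) = 1 ⊗ 1` and
`δ(V(nil)) = V(nil) ⊗ 1`. -/
noncomputable def deltaPair : Y → (Hnc ⊗[ℚ] Hnc) × (Hnc ⊗[ℚ] Hnc)
  | .nil => (1, ncTree (V .nil) ⊗ₜ 1)
  | .node _ l r =>
      ((deltaPair l).1 * (1 ⊗ₜ ncTree (V r) + (deltaPair r).2),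
        TensorProduct.map linV LinearMap.id ((deltaPair l).1 * (deltaPair r).2))

/-- `δ(V(t))` in `ℚY ⊗ ℚY`. -/
noncomputable def ncDeltaV (t : Y) : Hnc ⊗[ℚ] Hnc := (deltaPair t).2

/-- The coproduct on trees, as a morphism of monoids for the over product. -/
noncomputable def deltaTree : Y →* Hnc ⊗[ℚ] Hnc where
  toFun t := (deltaPair t).1
  map_one' := rfl
  map_mul' s t := by
    induction t with
    | nil => exact (mul_one _).symm
    | node _ l r hl _ =>
      change (deltaPair (s * l)).1 * _ = _ * ((deltaPair l).1 * _)
      rw [hl, mul_assoc]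

/-- The coproduct of `ℚY`, the algebra morphism with `Δ(V(t)) = 1 ⊗ V(t) + δ(V(t))`. -/
noncomputable def ncDelta : Hnc →ₐ[ℚ] Hnc ⊗[ℚ] Hnc := MonoidAlgebra.lift ℚ _ Y deltaTree

/-- The counit on trees. -/
noncomputable def epsTree : Y →* ℚ where
  toFun t := match t with
    | .nil => 1
    | .node _ _ _ => 0
  map_one' := rfl
  map_mul' s t := by
    cases t with
    | nil => exact (mul_one _).symm
    | node => exact (mul_zero _).symm

/-- The counit of `ℚY`, with value `1` on `nil` and `0` on all other trees. -/
noncomputable def ncEps : Hnc →ₐ[ℚ] ℚ := MonoidAlgebra.lift ℚ _ Y epsTree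

/-! ### The charge Hopf algebra -/

/-- The polynomial algebra `ℚ[V(t), t ∈ Y]`. The variable indexed by `t` stands for `V(t)`. -/
abbrev Halpha : Type := MvPolynomial Y ℚ

/-- The image of a tree in `ℚ[V(t), t ∈ Y]`: `V(t₁) / ⋯ / V(t_n)` is sent to the product of the
variables `V(t₁), …, V(t_n)`. -/
noncomputable def alphaTreeHom : Y →* Halpha where
  toFun := BinaryTree.rec 1 fun _ _ r cl _ => cl * MvPolynomial.X r
  map_one' := rfl
  map_mul' s t := by
    induction t with
    | nil => exact (mul_one _).symm
    | node _ l r hl _ =>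
      change BinaryTree.rec 1 (fun _ _ r cl _ => cl * MvPolynomial.X r) (s * l) *
          MvPolynomial.X r = _ * (_ * MvPolynomial.X r)
      rw [hl, mul_assoc]

/-- A tree as an element of `ℚ[V(t), t ∈ Y]`. -/
noncomputable def alphaTree (t : Y) : Halpha := alphaTreeHom t

/-- The projection of `ℚY` onto `ℚ[V(t), t ∈ Y]`. -/
noncomputable def abProj : Hnc →ₐ[ℚ] Halpha := MonoidAlgebra.lift ℚ _ Y alphaTreeHom

/-- `δ(V(t))` in the tensor square of `ℚ[V(t), t ∈ Y]`. -/
noncomputable def alphaDeltaV (t : Y) : Halpha ⊗[ℚ] Halpha :=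
  Algebra.TensorProduct.map abProj abProj (ncDeltaV t)

/-- The coproduct of `ℚ[V(t), t ∈ Y]`: the algebra morphism with
`Δ(V(t)) = 1 ⊗ V(t) + δ(V(t))`. -/
noncomputable def alphaDelta : Halpha →ₐ[ℚ] Halpha ⊗[ℚ] Halpha :=
  MvPolynomial.aeval fun t => 1 ⊗ₜ alphaTree (V t) + alphaDeltaV t

/-- The counit of `ℚ[V(t), t ∈ Y]`, zero on the generators. -/
noncomputable def alphaEps : Halpha →ₐ[ℚ] ℚ := MvPolynomial.aeval fun _ => 0

/-! ### The coordinate ring of the group `Grho` -/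

/-- The polynomial algebra on the trees different from `nil`. -/
abbrev Hrho : Type := MvPolynomial {t : Y // t ≠ .nil} ℚ

/-- A tree as an element of `Hrho`, where `nil` is identified with `1`. -/
noncomputable def rhoTree (t : Y) : Hrho := if h : t = .nil then 1 else MvPolynomial.X ⟨t, h⟩

/-- The coproduct of `Hrho`, given on the trees `u ≠ nil` by `1 ⊗ u` plus the sum of
`t ⊗ s₁ ⋯ s_{|t|} s_{|t|+1}` over all `u = μ_t(s₁ / vtx, …, s_{|t|} / vtx) / s_{|t|+1}`,
`t ≠ nil`. -/
noncomputable def rhoDelta : Hrho →ₐ[ℚ] Hrho ⊗[ℚ] Hrho :=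
  MvPolynomial.aeval fun u => 1 ⊗ₜ rhoTree u.1 +
    ∑ p ∈ rhoDecomp u.1, rhoTree p.1 ⊗ₜ ((p.2.1.map rhoTree).prod * rhoTree p.2.2)

/-- The counit of `Hrho`, zero on the generators. -/
noncomputable def rhoEps : Hrho →ₐ[ℚ] ℚ := MvPolynomial.aeval fun _ => 0

/-- The projection `R`: a generator `u = V(u₁) / ⋯ / V(u_n)` is sent to the product of the
`V(u_i)`. -/
noncomputable def R : Hrho →ₐ[ℚ] Halpha := MvPolynomial.aeval fun u => alphaTree u.1

end QEDCharge

namespace QEDCharge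

/-! ### Recursions for sums over decompositions of trees -/

section Sums

variable {M : Type*} [AddCommMonoid M]

/-! The series `g / x^vtx` is supported on the trees `s / vtx`, so right composition with it only
sees decompositions `u = μ_t(s₁ / vtx, …)`; this is `subst`. Right composition respects the over
product, hence `(f / x^vtx) ∘ (g / x^vtx) = ((f ∘ (g / x^vtx)) / g) / x^vtx`: in the coordinate `f`
the group law is `rhoMul`. Splitting trees as `a / V(r)` gives recursions (`subst_node`,
`substOver_node`), from which associativity follows by induction on the order (`subst_subst`,
`rhoMul_assoc`). The coproduct `rhoDelta` is `rhoMul` evaluated on the generic series with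
coefficients `t ⊗ 1` and `1 ⊗ t` (`comp_rhoDelta`), so that coassociativity of `Hrho` is
associativity of `rhoMul`, and characters convolve as series compose.

In `ℚY` the factors do not commute, and series over commutative rings are of no help. The substitute
is the coaction `κ(u) = ∑ t ⊗ s₁ / ⋯ / s_{|t|}`, which satisfies `κ(x / V(y)) = Δ(x) / (V ⊗ Id)κ(y)`
and `Δ(V(x)) = 1 ⊗ V(x) + (V ⊗ Id)κ(x)`. These rules identify the recursive coproduct with the
explicit sums (`deltaPair_eq`), and they propagate coassociativity together with `(κ ⊗ Id)κ = (Id ⊗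
Δ)κ` from `x` and `y` to `x / V(y)` (`coassoc_mul`).

`Halpha` inherits the bialgebra axioms from `ℚY` through the surjection `abProj`. The explicit
formula for `Δ(u)` on all trees `u` has the shape of `rhoDelta`, so `R` is compatible with the
coproducts, and the composition law of `Galpha` is that of `Grho` restricted along `R`. The inverse
`g` of `x^nil - x^vtx \ f` is characterised by `g_nil = 1` and `g_{a / V(r)} = g_a f_r`: it is
multiplicative in the factors `V(t)`, which is the same as a character of `ℚ[V(t)]`.

All three bialgebras are connected graded, so the geometric series of `1 - Id` for convolution
yields an antipode (`exists_antipode`). In the commutative cases the characters then form groups,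
transported to the sets of series. -/

theorem treeProd_node (l r : Y) (L L' : List Y) (s : Y) (hL : L.length = l.numNodes) :
    treeProd (.node () l r) ((L ++ s :: L').map fun s => graftOver s vtx) =
      .node () (graftOver (treeProd l (L.map fun s => graftOver s vtx)) s)
        (treeProd r (L'.map fun s => graftOver s vtx)) := by
  have h1 : ((L ++ s :: L').map fun s => graftOver s vtx).getD l.numNodes .nil =
      graftOver s vtx := by simp [← hL]
  have h2 : ((L ++ s :: L').map fun s => graftOver s vtx).take l.numNodes =
      L.map fun s => graftOver s vtx := by simp [← hL]
  have h3 : ((L ++ s :: L').map fun s => graftOver s vtx).drop (l.numNodes + 1) =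
      L'.map fun s => graftOver s vtx := by simp [← hL, List.drop_append]
  rw [treeProd, h1, h2, h3]
  simp [vtx, graftOver, graftUnder]

theorem mem_alphaDecomp {u : Y} {p : Y × List Y} : p ∈ alphaDecomp u ↔
    p.2.length = p.1.numNodes ∧ treeProd p.1 (p.2.map fun s => graftOver s vtx) = u := by
  simp [alphaDecomp]

theorem mem_rhoDecomp {u : Y} {p : Y × List Y × Y} : p ∈ rhoDecomp u ↔
    p.1 ≠ .nil ∧ p.2.1.length = p.1.numNodes ∧
      graftOver (treeProd p.1 (p.2.1.map fun s => graftOver s vtx)) p.2.2 = u := by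
  simp [rhoDecomp]

theorem overPairs_nil : overPairs .nil = {(.nil, .nil)} := by
  ext ⟨p, q⟩
  rw [mem_overPairs]
  cases q <;> simp [graftOver]

/-- Cutting the left-most branch of `a / V(r)` either keeps the whole tree, or happens inside `a`
and leaves `V(r)` with the right-hand piece. -/
theorem sum_overPairs_node (a r : Y) (F : Y × Y → M) :
    ∑ p ∈ overPairs (.node () a r), F p =
      F (.node () a r, .nil) + ∑ p ∈ overPairs a, F (p.1, .node () p.2 r) := by
  have h : overPairs (.node () a r) = insert (.node () a r, .nil)
      ((overPairs a).image fun p => (p.1, .node () p.2 r)) := by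
    ext ⟨p, q⟩
    cases q with
    | nil => simp [mem_overPairs, graftOver]
    | node x l s =>
      simp only [mem_overPairs, graftOver, Finset.mem_insert, Finset.mem_image, Prod.mk.injEq,
        BinaryTree.node.injEq, Prod.exists]
      aesop
  rw [h, Finset.sum_insert (by simp), Finset.sum_image]
  rintro ⟨p, q⟩ - ⟨p', q'⟩ - h
  simpa using h

theorem alphaDecomp_nil : alphaDecomp .nil = {(.nil, [])} := by
  ext ⟨t, L⟩
  rw [mem_alphaDecomp]
  cases t with
  | nil => simp [treeProd]
  | node x l r =>
    simp only [Finset.mem_singleton, Prod.mk.injEq, reduceCtorEq, false_and, iff_false, not_and]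
    intro h h'
    -- Each substituted tree `s / vtx` has a vertex, so a nonempty `t` cannot produce `nil`.
    have := congrArg BinaryTree.numNodes h'
    rw [numNodes_treeProd _ _ (by simpa using h)] at this
    have h4 : ∀ s ∈ L.map (fun s => graftOver s vtx), s ≠ .nil := by simp [vtx, graftOver]
    have h5 := length_le_sum_numNodes h4
    simp at h h5 this
    omega

/-- An element of `rhoDecomp` is a cut `u = p / q` together with a decomposition of `p`. The
isolated term is `t = nil`, which `rhoDecomp` excludes and which forces `q = u`. -/
theorem sum_rhoDecomp (u : Y) (F : Y × List Y × Y → M) :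
    F (.nil, [], u) + ∑ p ∈ rhoDecomp u, F p =
      ∑ p ∈ overPairs u, ∑ d ∈ alphaDecomp p.1, F (d.1, d.2, p.2) := by
  classical
  have h : ((overPairs u).sigma fun p => alphaDecomp p.1).image
      (fun x => (x.2.1, x.2.2, x.1.2)) = insert (.nil, [], u) (rhoDecomp u) := by
    ext ⟨t, L, s⟩
    simp only [Finset.mem_image, Finset.mem_sigma, mem_overPairs, mem_alphaDecomp,
      Finset.mem_insert, mem_rhoDecomp]
    constructor
    · rintro ⟨⟨⟨p, q⟩, t', L'⟩, ⟨h1, h2, h3⟩, h4⟩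
      simp only [Prod.mk.injEq] at h1 h2 h3 h4
      obtain ⟨rfl, rfl, rfl⟩ := h4
      subst h3
      by_cases ht : t' = .nil
      · subst ht
        left
        simp at h2
        subst h2
        simpa [treeProd, nil_graftOver] using h1
      · exact Or.inr ⟨ht, h2, h1⟩
    · rintro (h | ⟨-, h1, h2⟩)
      · simp only [Prod.mk.injEq] at h
        obtain ⟨rfl, rfl, rfl⟩ := h
        exact ⟨⟨(.nil, s), (.nil, [])⟩, by simp [nil_graftOver, treeProd], rfl⟩
      · exact ⟨⟨(_, s), (t, L)⟩, ⟨h2, h1, rfl⟩, rfl⟩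
  rw [← Finset.sum_insert (by simp [mem_rhoDecomp]), ← h, Finset.sum_image, Finset.sum_sigma]
  rintro ⟨⟨p, q⟩, t, L⟩ h1 ⟨⟨p', q'⟩, t', L'⟩ h2 h3
  simp [mem_overPairs, mem_alphaDecomp] at h1 h2 h3
  obtain ⟨rfl, rfl, rfl⟩ := h3
  obtain ⟨-, -, rfl⟩ := h1
  obtain ⟨-, -, rfl⟩ := h2
  rfl

/-- If `s / vtx` replaces the root of `t`, its `vtx` becomes the root of the result. Hence `a` is a
product `μ_l(…) / s`, where `l` is the left subtree of `t`, and `r` is decomposed independently by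
the right subtree. -/
theorem sum_alphaDecomp_node (a r : Y) (F : Y × List Y → M) :
    ∑ d ∈ alphaDecomp (.node () a r), F d =
      ∑ p ∈ overPairs a, ∑ d ∈ alphaDecomp p.1, ∑ e ∈ alphaDecomp r,
        F (.node () d.1 e.1, d.2 ++ p.2 :: e.2) := by
  classical
  have h : ((overPairs a).sigma fun p => alphaDecomp p.1 ×ˢ alphaDecomp r).image
      (fun x => ((.node () x.2.1.1 x.2.2.1 : Y), x.2.1.2 ++ x.1.2 :: x.2.2.2)) =
      alphaDecomp (.node () a r) := by
    ext ⟨t, L⟩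
    simp only [Finset.mem_image, Finset.mem_sigma, mem_overPairs, mem_alphaDecomp,
      Finset.mem_product]
    constructor
    · rintro ⟨⟨⟨p, q⟩, ⟨t, L⟩, ⟨t', L'⟩⟩, ⟨h1, ⟨h2, h5⟩, h3, h6⟩, h4⟩
      simp only [Prod.mk.injEq] at h1 h2 h3 h4 h5 h6
      obtain ⟨rfl, rfl⟩ := h4
      subst h5 h6
      refine ⟨by simp [h2, h3]; omega, ?_⟩
      rw [treeProd_node _ _ _ _ _ h2, h1]
    · rintro ⟨h1, h2⟩
      cases t with
      | nil => simp [treeProd] at h2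
      | node x l r' =>
        simp only [BinaryTree.numNodes] at h1
        have hlt : l.numNodes < L.length := by omega
        have e : L = L.take l.numNodes ++ L[l.numNodes] :: L.drop (l.numNodes + 1) := by
          rw [List.cons_getElem_drop_succ, List.take_append_drop]
        rw [e, treeProd_node _ _ _ _ _ (by simp; omega)] at h2
        simp only [BinaryTree.node.injEq, true_and] at h2
        exact ⟨⟨(_, L[l.numNodes]), (l, L.take l.numNodes), (r', L.drop (l.numNodes + 1))⟩,
          ⟨h2.1, ⟨by simp; omega, rfl⟩, by simp; omega, h2.2⟩, by simp⟩
  rw [← h, Finset.sum_image, Finset.sum_sigma]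
  · exact Finset.sum_congr rfl fun p _ => Finset.sum_product ..
  rintro ⟨⟨p, q⟩, ⟨t, L⟩, ⟨s, K⟩⟩ h1 ⟨⟨p', q'⟩, ⟨t', L'⟩, ⟨s', K'⟩⟩ h2 h3
  simp [mem_overPairs, mem_alphaDecomp] at h1 h2 h3
  obtain ⟨⟨rfl, rfl⟩, h3⟩ := h3
  obtain ⟨-, ⟨e1, rfl⟩, -⟩ := h1
  obtain ⟨-, ⟨e2, rfl⟩, -⟩ := h2
  obtain ⟨rfl, h4⟩ := List.append_inj h3 (e1.trans e2.symm)
  simp at h4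
  obtain ⟨rfl, rfl⟩ := h4
  rfl

end Sums

/-! ### Right composition by series of the form `g / x^vtx` -/

section Substitution

variable {A : Type*} [CommRing A]

/-- The coefficient of `x^u` in the composition of `φ` with `g / x^vtx`. -/
noncomputable def subst (g : Y → A) (u : Y) (φ : Y → A) : A :=
  ∑ d ∈ alphaDecomp u, φ d.1 * (d.2.map g).prod

/-- The coefficient of `x^u` in the over product of `φ ∘ (g / x^vtx)` with `w`. -/
noncomputable def substOver (g w : Y → A) (u : Y) (φ : Y → A) : A :=
  ∑ p ∈ overPairs u, subst g p.1 φ * w p.2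

/-- The group law of `Grho` in the coordinates `f ↦ f / x^vtx`. -/
noncomputable def rhoMul (f g : Y → A) : Y → A := fun u => substOver g g u f

theorem subst_sum (g : Y → A) (u : Y) {ι : Type*} (s : Finset ι) (F : ι → Y → A) :
    subst g u (fun v => ∑ i ∈ s, F i v) = ∑ i ∈ s, subst g u (F i) := by
  simp only [subst, Finset.sum_mul]
  exact Finset.sum_comm

theorem subst_mul (g : Y → A) (u : Y) (F : Y → A) (c : A) :
    subst g u (fun v => F v * c) = subst g u F * c := by
  simp only [subst, Finset.sum_mul]
  exact Finset.sum_congr rfl fun _ _ => by ring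

theorem subst_add (g : Y → A) (u : Y) (F G : Y → A) :
    subst g u (fun v => F v + G v) = subst g u F + subst g u G := by
  simp only [subst, add_mul, Finset.sum_add_distrib]

theorem substOver_mul (g w : Y → A) (u : Y) (F : Y → A) (c : A) :
    substOver g w u (fun v => F v * c) = substOver g w u F * c := by
  simp only [substOver, subst_mul, Finset.sum_mul]
  exact Finset.sum_congr rfl fun _ _ => by ring

theorem substOver_mul_left (g w : Y → A) (u : Y) (F : Y → A) (c : A) :
    substOver g w u (fun v => c * F v) = c * substOver g w u F := by
  simp only [mul_comm c, substOver_mul]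

theorem substOver_add (g w : Y → A) (u : Y) (F G : Y → A) :
    substOver g w u (fun v => F v + G v) = substOver g w u F + substOver g w u G := by
  simp only [substOver, subst_add, add_mul, Finset.sum_add_distrib]

theorem subst_nil (g φ : Y → A) : subst g .nil φ = φ .nil := by
  simp [subst, alphaDecomp_nil]

theorem substOver_nil (g w φ : Y → A) : substOver g w .nil φ = φ .nil * w .nil := by
  simp [substOver, overPairs_nil, subst_nil]

theorem subst_node (g : Y → A) (a r : Y) (φ : Y → A) :
    subst g (.node () a r) φ =
      substOver g g a fun x => subst g r fun y => φ (.node () x y) := by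
  rw [subst, sum_alphaDecomp_node]
  simp only [substOver, subst, Finset.sum_mul]
  refine Finset.sum_congr rfl fun p _ => Finset.sum_congr rfl fun d _ =>
    Finset.sum_congr rfl fun e _ => ?_
  simp only [List.map_append, List.map_cons, List.prod_append, List.prod_cons]
  ring

theorem substOver_node (g w : Y → A) (a r : Y) (φ : Y → A) :
    substOver g w (.node () a r) φ =
      subst g (.node () a r) φ * w .nil + substOver g (fun q => w (.node () q r)) a φ := by
  rw [substOver, sum_overPairs_node]; rfl

theorem substOver_eq_sum (g : Y → A) (u : Y) (f : Y → A) :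
    substOver g g u f = f .nil * g u +
      ∑ p ∈ rhoDecomp u, f p.1 * ((p.2.1.map g).prod * g p.2.2) := by
  have h := sum_rhoDecomp u fun p => f p.1 * ((p.2.1.map g).prod * g p.2.2)
  simp only [List.map_nil, List.prod_nil, one_mul] at h
  rw [h]
  simp only [substOver, subst, Finset.sum_mul, mul_assoc]

/-- Right composition respects the over product. A function `F` of two trees replaces a product of
two series because `subst_node` nests substitutions, and `w` is arbitrary because `substOver_node`
replaces it by `w (node () · r)`. Both claims at `node () a r` rest on the second one at `a`. -/
theorem subst_overPairs_aux (h : Y → A) (u : Y) :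
    (∀ F : Y → Y → A, subst h u (fun v => ∑ p ∈ overPairs v, F p.1 p.2) =
      ∑ p ∈ overPairs u, subst h p.1 fun x => subst h p.2 fun y => F x y) ∧
    ∀ (w : Y → A) (F : Y → Y → A), substOver h w u (fun v => ∑ p ∈ overPairs v, F p.1 p.2) =
      ∑ p ∈ overPairs u, subst h p.1 fun x => substOver h w p.2 fun y => F x y := by
  induction u with
  | nil =>
    constructor <;> intros <;> simp [overPairs_nil, subst_nil, substOver_nil]
  | node x a r ha _ =>
    cases x
    have h1 : ∀ F : Y → Y → A, subst h (.node () a r) (fun v => ∑ p ∈ overPairs v, F p.1 p.2) =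
        ∑ p ∈ overPairs (.node () a r), subst h p.1 fun x => subst h p.2 fun y => F x y := by
      intro F
      have := ha.2 h fun x x' => subst h r fun y => F x (.node () x' y)
      simp only [subst_node h a r, sum_overPairs_node, subst_add, subst_sum, substOver_add, this,
        subst_nil, subst_node h _ r]
    refine ⟨h1, fun w F => ?_⟩
    rw [substOver_node, h1, ha.2]
    simp only [sum_overPairs_node, substOver_node, subst_nil, substOver_nil, subst_add, subst_mul,
      Finset.sum_add_distrib, add_mul, Finset.sum_mul]
    ring

theorem substOver_overPairs (h w : Y → A) (u : Y) (F : Y → Y → A) :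
    substOver h w u (fun v => ∑ p ∈ overPairs v, F p.1 p.2) =
      ∑ p ∈ overPairs u, subst h p.1 fun x => substOver h w p.2 fun y => F x y :=
  (subst_overPairs_aux h u).2 w F

theorem substOver_subst_comm (g h w : Y → A) (u v : Y) (F : Y → Y → A) :
    subst h u (fun x => substOver g w v fun y => F x y) =
      substOver g w v fun y => subst h u fun x => F x y := by
  simp only [substOver, subst, Finset.sum_mul]
  rw [Finset.sum_comm]
  refine Finset.sum_congr rfl fun p _ => ?_
  rw [Finset.sum_comm]
  exact Finset.sum_congr rfl fun d _ => Finset.sum_congr rfl fun e _ => by ring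

/-- With `γ = g / x^vtx` and `η = h / x^vtx` this reads `(((φ ∘ γ) / w) ∘ η) / h = (φ ∘ (γ ∘ η)) /
((w ∘ η) / h)`. Associativity is assumed only on the left pieces of cuts of `u`, so that the lemma
can serve inside an induction on the order. -/
theorem substOver_substOver_of (g h w : Y → A) (u : Y)
    (H : ∀ p ∈ overPairs u, ∀ φ, subst h p.1 (fun v => subst g v φ) =
      subst (rhoMul g h) p.1 φ) (φ : Y → A) :
    substOver h h u (fun v => substOver g w v φ) =
      substOver (rhoMul g h) (rhoMul w h) u φ := by
  have := substOver_overPairs h h u fun p q => subst g p φ * w q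
  simp only [substOver_mul_left, subst_mul] at this
  rw [show (fun v => substOver g w v φ) = fun v => ∑ p ∈ overPairs v, subst g p.1 φ * w p.2 from rfl,
    this]
  exact Finset.sum_congr rfl fun p hp => by rw [H p hp]; rfl

theorem subst_subst (g h : Y → A) (u : Y) (φ : Y → A) :
    subst h u (fun v => subst g v φ) = subst (rhoMul g h) u φ := by
  induction hn : u.numNodes using Nat.strong_induction_on generalizing u φ with
  | _ n ih =>
    subst hn
    cases u with
    | nil => simp [subst_nil]
    | node x a r =>
      cases x
      simp only [BinaryTree.numNodes] at ih
      simp only [subst_node]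
      -- The substitution of `h` in the right subtree moves past that of `g` in the left one, which
      -- makes the two substitutions in the right subtree adjacent.
      simp only [substOver_subst_comm]
      simp only [fun y => ih r.numNodes (by omega) r y rfl]
      apply substOver_substOver_of
      intro p hp φ
      refine ih p.1.numNodes ?_ p.1 φ rfl
      have := congrArg BinaryTree.numNodes (mem_overPairs.1 hp)
      rw [numNodes_graftOver] at this
      omega

theorem rhoMul_assoc (f g h : Y → A) : rhoMul (rhoMul f g) h = rhoMul f (rhoMul g h) :=
  funext fun u => substOver_substOver_of g h g u (fun _ _ => subst_subst g h _) f

theorem rhoMul_nil (f g : Y → A) : rhoMul f g .nil = f .nil * g .nil := substOver_nil ..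

/-! ### Composition of series -/

theorem overMul_vtx_nil (g : Y → A) : overMul g (xpow vtx) .nil = 0 := by
  simp [overMul, overPairs_nil, xpow, vtx]

theorem overMul_vtx_node (g : Y → A) (a r : Y) :
    overMul g (xpow vtx) (.node () a r) = if r = .nil then g a else 0 := by
  rw [overMul, sum_overPairs_node]
  have h1 : (xpow vtx .nil : A) = 0 := by simp [xpow, vtx]
  simp only [h1, mul_zero, zero_add]
  cases a with
  | nil => by_cases hr : r = .nil <;> simp [overPairs_nil, xpow, vtx, hr]
  | node _ l s =>
    rw [sum_overPairs_node, Finset.sum_eq_zero fun p _ => by simp [xpow, vtx]]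
    by_cases hr : r = .nil <;> simp [xpow, vtx, hr]

theorem overMul_vtx_graftOver (g : Y → A) (s : Y) :
    overMul g (xpow vtx) (graftOver s vtx) = g s := by
  simp [vtx, graftOver]
  simpa [vtx] using overMul_vtx_node g s .nil

theorem overMul_vtx_injective :
    Function.Injective fun g : Y → A => overMul g (xpow vtx) := fun g g' h => by
  ext s
  rw [← overMul_vtx_graftOver g, ← overMul_vtx_graftOver g']
  exact congrFun h _

/-- A term with some factor not of the form `s / vtx` vanishes, because `g / x^vtx` has coefficient
zero there; the remaining terms are indexed by `alphaDecomp`. -/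
theorem comp_overMul_vtx (φ g : Y → A) (u : Y) :
    comp φ (overMul g (xpow vtx)) u = subst g u φ := by
  classical
  have hi : Function.Injective fun s : Y => graftOver s vtx := fun s t h => by
    simpa [vtx, graftOver] using h
  have hsub : (alphaDecomp u).image (fun d => (d.1, d.2.map fun s => graftOver s vtx)) ⊆
      decomp u := by
    intro p hp
    simp only [Finset.mem_image, mem_alphaDecomp] at hp
    obtain ⟨⟨t, L⟩, ⟨h1, h2⟩, rfl⟩ := hp
    simp only [decomp, Set.Finite.mem_toFinset, Set.mem_ofPred_eq]
    exact ⟨by simpa using h1, by simp [vtx, graftOver], h2⟩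
  rw [comp, ← Finset.sum_subset hsub, Finset.sum_image, subst]
  · refine Finset.sum_congr rfl fun d _ => ?_
    simp only [List.map_map, Function.comp_def, overMul_vtx_graftOver]
  · rintro ⟨t, L⟩ - ⟨t', L'⟩ - h
    simp only [Prod.mk.injEq] at h
    exact Prod.ext h.1 (List.map_injective_iff.2 hi h.2)
  · rintro ⟨t, L⟩ h1 h2
    simp only [decomp, Set.Finite.mem_toFinset, Set.mem_ofPred_eq] at h1
    by_cases hL : ∀ s ∈ L, ∃ s', s = graftOver s' vtx
    · refine absurd ?_ h2
      choose! k hk using hL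
      have : L = (L.map k).map fun s => graftOver s vtx := by
        rw [List.map_map]
        conv_lhs => rw [← List.map_id L]
        exact List.map_congr_left fun s hs => hk s hs
      simp only [Finset.mem_image, mem_alphaDecomp]
      refine ⟨(t, L.map k), ⟨by simpa using h1.1, ?_⟩, Prod.ext rfl this.symm⟩
      rw [← this]
      exact h1.2.2
    · push Not at hL
      obtain ⟨s, hs, h⟩ := hL
      have h0 : overMul g (xpow vtx) s = 0 := by
        cases s with
        | nil => exact overMul_vtx_nil g
        | node x a r =>
          rw [overMul_vtx_node, if_neg]
          rintro rfl
          exact h a rfl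
      rw [List.prod_eq_zero (h0 ▸ List.mem_map_of_mem hs), mul_zero]

theorem comp_overMul_vtx_overMul_vtx (f g : Y → A) :
    comp (overMul f (xpow vtx)) (overMul g (xpow vtx)) = overMul (rhoMul f g) (xpow vtx) := by
  ext u
  rw [comp_overMul_vtx]
  cases u with
  | nil => rw [subst_nil, overMul_vtx_nil, overMul_vtx_nil]
  | node x a r =>
    cases x
    rw [subst_node, overMul_vtx_node]
    simp only [overMul_vtx_node]
    cases r with
    | nil => simp [subst_nil, rhoMul]
    | node x b c =>
      cases x
      -- Decompositions of a nonempty tree have `t ≠ nil`, so a function supported at `nil`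
      -- contributes nothing.
      have h0 (k : A) : subst g (.node () b c) (fun y => if y = .nil then k else 0) = 0 := by
        rw [subst_node]
        simp [substOver, subst]
      simp only [h0]
      simp [substOver, subst]

theorem map_comp_series {B : Type*} [CommRing B] (h : A →+* B) (φ ψ : Y → A) (u : Y) :
    h (comp φ ψ u) = comp (fun t => h (φ t)) (fun t => h (ψ t)) u := by
  simp [comp, map_sum, map_list_prod, Function.comp_def]

theorem map_rhoMul {B : Type*} [CommRing B] (h : A →+* B) (f g : Y → A) (u : Y) :
    h (rhoMul f g u) = rhoMul (fun t => h (f t)) (fun t => h (g t)) u := by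
  simp [rhoMul, substOver, subst, map_sum, map_list_prod, Function.comp_def]

theorem map_overMul_vtx {B : Type*} [CommRing B] (h : A →+* B) (f : Y → A) (u : Y) :
    h (overMul f (xpow vtx) u) = overMul (fun t => h (f t)) (xpow vtx) u := by
  cases u with
  | nil => simp [overMul_vtx_nil]
  | node _ a r => rw [overMul_vtx_node, overMul_vtx_node, apply_ite h, map_zero]

end Substitution

/-! ### The non-recursive formula and the coassociativity of the coproduct of `ℚY` -/

theorem ncTree_mul (s t : Y) : ncTree (s * t) = ncTree s * ncTree t := by
  simp [ncTree, MonoidAlgebra.single_mul_single]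

theorem ncTree_nil : ncTree .nil = 1 := rfl

theorem node_eq_mul (l r : Y) : (.node () l r : Y) = l * V r := rfl

theorem ncTree_node (l r : Y) : ncTree (.node () l r) = ncTree l * ncTree (V r) := by
  rw [node_eq_mul, ncTree_mul]

theorem linV_ncTree (t : Y) : linV (ncTree t) = ncTree (V t) := by
  simp [linV, ncTree]

theorem ncDelta_ncTree (t : Y) : ncDelta (ncTree t) = (deltaPair t).1 := by
  rw [ncDelta, ncTree, MonoidAlgebra.lift_single, one_smul]
  rfl

theorem deltaPair_node_fst (l r : Y) : (deltaPair (.node () l r)).1 =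
    (deltaPair l).1 * (1 ⊗ₜ ncTree (V r) + (deltaPair r).2) := rfl

theorem deltaPair_node_snd (l r : Y) : (deltaPair (.node () l r)).2 =
    TensorProduct.map linV LinearMap.id ((deltaPair l).1 * (deltaPair r).2) := rfl

/-- The right coaction of `ℚY` on itself, given on trees by
`∑ t ⊗ s₁ / ⋯ / s_{|t|}` over all `u = μ_t(s₁ / vtx, …, s_{|t|} / vtx)`. -/
noncomputable def coactTree (u : Y) : Hnc ⊗[ℚ] Hnc :=
  ∑ d ∈ alphaDecomp u, ncTree d.1 ⊗ₜ (d.2.map ncTree).prod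

theorem map_linV_coactTree (u : Y) : TensorProduct.map linV LinearMap.id (coactTree u) =
    ∑ d ∈ alphaDecomp u, ncTree (V d.1) ⊗ₜ (d.2.map ncTree).prod := by
  simp [coactTree, map_sum, linV_ncTree]

theorem sum_coact_node (a r : Y) (w : Y → Hnc) :
    ∑ p ∈ overPairs (.node () a r), coactTree p.1 * (1 ⊗ₜ w p.2) =
      coactTree (.node () a r) * (1 ⊗ₜ w .nil) +
        ∑ p ∈ overPairs a, coactTree p.1 * (1 ⊗ₜ w (.node () p.2 r)) :=
  sum_overPairs_node (M := Hnc ⊗[ℚ] Hnc) a r fun p => coactTree p.1 * (1 ⊗ₜ[ℚ] w p.2)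

/-- The factors come in the order left subtree, root, right subtree, which is also the order of the
product on the right; no commutation is needed. -/
theorem coactTree_node (a r : Y) : coactTree (.node () a r) =
    (∑ p ∈ overPairs a, coactTree p.1 * (1 ⊗ₜ ncTree p.2)) *
      TensorProduct.map linV LinearMap.id (coactTree r) := by
  rw [map_linV_coactTree, coactTree, sum_alphaDecomp_node]
  simp only [coactTree, Finset.sum_mul]
  refine Finset.sum_congr rfl fun p _ => Finset.sum_congr rfl fun d _ => ?_
  rw [Finset.mul_sum]
  refine Finset.sum_congr rfl fun e _ => ?_
  simp [ncTree_node, mul_assoc]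

/-- At `a / V(r)` the two terms of `Δ(V(r))` match the two kinds of cuts: `1 ⊗ V(r)` accounts for
the cuts inside `a`, and `δ(V(r))` for the cut keeping the whole tree. The recursion for `δ` is
`coactTree_node` with `V ⊗ Id` applied. -/
theorem deltaPair_eq (u : Y) :
    (deltaPair u).1 = ∑ p ∈ overPairs u, coactTree p.1 * (1 ⊗ₜ ncTree p.2) ∧
    (deltaPair u).2 = TensorProduct.map linV LinearMap.id (coactTree u) := by
  induction u with
  | nil =>
    constructor
    · simp [overPairs_nil, coactTree, alphaDecomp_nil, deltaPair, ncTree_nil,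
        Algebra.TensorProduct.one_def]
    · simp [coactTree, alphaDecomp_nil, deltaPair, linV_ncTree]
  | node x a r ha hr =>
    cases x
    rw [deltaPair_node_fst, deltaPair_node_snd, hr.2, ha.1, ← coactTree_node]
    refine ⟨?_, rfl⟩
    rw [mul_add, ← coactTree_node, sum_coact_node, add_comm, ncTree_nil]
    simp only [ncTree_node, Finset.sum_mul, mul_assoc, Algebra.TensorProduct.tmul_mul_tmul, mul_one]
    rw [← Algebra.TensorProduct.one_def, mul_one]

theorem ncDelta_ncTree_eq (u : Y) :
    ncDelta (ncTree u) = ∑ p ∈ overPairs u, coactTree p.1 * (1 ⊗ₜ ncTree p.2) := by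
  rw [ncDelta_ncTree, (deltaPair_eq u).1]

theorem ncDelta_V (u : Y) : ncDelta (ncTree (V u)) = 1 ⊗ₜ ncTree (V u) +
    TensorProduct.map linV LinearMap.id (coactTree u) := by
  rw [← (deltaPair_eq u).2, ncDelta_ncTree]
  exact one_mul _

theorem ncDelta_ncTree_eq_sum (u : Y) : ncDelta (ncTree u) = 1 ⊗ₜ ncTree u +
    ∑ p ∈ rhoDecomp u, ncTree p.1 ⊗ₜ ((p.2.1.map ncTree).prod * ncTree p.2.2) := by
  have h := sum_rhoDecomp u fun p => ncTree p.1 ⊗ₜ[ℚ] ((p.2.1.map ncTree).prod * ncTree p.2.2)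
  simp only [List.map_nil, List.prod_nil, one_mul, ncTree_nil] at h
  rw [h, ncDelta_ncTree_eq]
  simp only [coactTree, Finset.sum_mul, Algebra.TensorProduct.tmul_mul_tmul, mul_one]

theorem coactTree_node_eq (a r : Y) : coactTree (.node () a r) =
    ncDelta (ncTree a) * TensorProduct.map linV LinearMap.id (coactTree r) := by
  rw [coactTree_node, ncDelta_ncTree_eq]

theorem coactTree_nil : coactTree .nil = 1 := by
  simp [coactTree, alphaDecomp_nil, ncTree_nil, Algebra.TensorProduct.one_def]

/-- The linear extension of `coactTree`. -/
noncomputable def coact : Hnc →ₗ[ℚ] Hnc ⊗[ℚ] Hnc :=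
  (MonoidAlgebra.basis Y ℚ).constr ℚ coactTree

theorem coact_ncTree (t : Y) : coact (ncTree t) = coactTree t :=
  (MonoidAlgebra.basis Y ℚ).constr_basis ℚ coactTree t

theorem Hnc_induction {p : Hnc → Prop} (x : Hnc) (tree : ∀ t, p (ncTree t))
    (add : ∀ x y, p x → p y → p (x + y)) (smul : ∀ (c : ℚ) x, p x → p (c • x)) : p x :=
  MonoidAlgebra.induction_on x tree add smul

theorem coact_mul_linV (x y : Hnc) : coact (x * linV y) =
    ncDelta x * TensorProduct.map linV LinearMap.id (coact y) := by
  induction x using Hnc_induction with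
  | tree a =>
    induction y using Hnc_induction with
    | tree r => rw [linV_ncTree, ← ncTree_node, coact_ncTree, coact_ncTree, coactTree_node_eq]
    | add y z hy hz => simp only [map_add, mul_add, hy, hz]
    | smul c y hy => simp only [map_smul, mul_smul_comm, hy]
  | add x z hx hz => simp only [map_add, add_mul, hx, hz]
  | smul c x hx => simp only [map_smul, smul_mul_assoc, hx]

theorem ncDelta_linV (x : Hnc) : ncDelta (linV x) =
    1 ⊗ₜ linV x + TensorProduct.map linV LinearMap.id (coact x) := by
  induction x using Hnc_induction with
  | tree a => rw [linV_ncTree, ncDelta_V, coact_ncTree]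
  | add x z hx hz => simp only [map_add, TensorProduct.tmul_add, hx, hz]; abel
  | smul c x hx => simp only [map_smul, TensorProduct.tmul_smul, hx, smul_add]

theorem Hnc_algHom_ext {B : Type*} [Semiring B] [Algebra ℚ B] {f g : Hnc →ₐ[ℚ] B}
    (h : ∀ t, f (ncTree (V t)) = g (ncTree (V t))) : f = g := by
  ext t
  change f (ncTree t) = g (ncTree t)
  induction t with
  | nil => rw [ncTree_nil, map_one, map_one]
  | node x l r hl _ =>
    cases x
    rw [ncTree_node, map_mul, map_mul, hl, h]

/-! ### Coassociativity from a coaction and a linear operator `v` -/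

section Coassoc

variable {H : Type*} [Ring H] [Algebra ℚ H] (Δ : H →ₐ[ℚ] H ⊗[ℚ] H) (v : H →ₗ[ℚ] H)
  (κ : H →ₗ[ℚ] H ⊗[ℚ] H)

/-- `(Δ ⊗ Id)`, reassociated. -/
noncomputable def deltaLeft : H ⊗[ℚ] H →ₐ[ℚ] H ⊗[ℚ] (H ⊗[ℚ] H) :=
  (Algebra.TensorProduct.assoc ℚ ℚ ℚ H H H).toAlgHom.comp
    (Algebra.TensorProduct.map Δ (.id ℚ H))

/-- `(Id ⊗ Δ)`. -/
noncomputable def deltaRight : H ⊗[ℚ] H →ₐ[ℚ] H ⊗[ℚ] (H ⊗[ℚ] H) :=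
  Algebra.TensorProduct.map (.id ℚ H) Δ

/-- `(κ ⊗ Id)`, reassociated. -/
noncomputable def coactLeft : H ⊗[ℚ] H →ₗ[ℚ] H ⊗[ℚ] (H ⊗[ℚ] H) :=
  (TensorProduct.assoc ℚ H H H).toLinearMap ∘ₗ TensorProduct.map κ LinearMap.id

/-- `v ⊗ Id`. -/
noncomputable def mapLeft (B : Type*) [AddCommGroup B] [Module ℚ B] : H ⊗[ℚ] B →ₗ[ℚ] H ⊗[ℚ] B :=
  TensorProduct.map v LinearMap.id

theorem assoc_mapLeft (z : H ⊗[ℚ] H) (y : H) :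
    TensorProduct.assoc ℚ H H H (mapLeft v H z ⊗ₜ y) =
      mapLeft v (H ⊗[ℚ] H) (TensorProduct.assoc ℚ H H H (z ⊗ₜ y)) := by
  induction z with
  | zero => simp
  | tmul a b => simp [mapLeft]
  | add a b ha hb => simp only [map_add, TensorProduct.add_tmul, ha, hb]

variable {Δ v κ}

/-- The rule `hκ` acts in the first tensor factor while the second factors are merely multiplied,
and reassociation is an algebra morphism. -/
theorem coactLeft_mul (hκ : ∀ x y, κ (x * v y) = Δ x * mapLeft v H (κ y)) (X Z : H ⊗[ℚ] H) :
    coactLeft κ (X * mapLeft v H Z) = deltaLeft Δ X * mapLeft v (H ⊗[ℚ] H) (coactLeft κ Z) := by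
  induction X with
  | zero => simp
  | add a b ha hb => simp only [map_add, add_mul, ha, hb]
  | tmul x x' =>
    induction Z with
    | zero => simp
    | add a b ha hb => simp only [map_add, mul_add, ha, hb]
    | tmul y y' =>
      have h1 : (x ⊗ₜ x') * mapLeft v H (y ⊗ₜ y') = (x * v y) ⊗ₜ[ℚ] (x' * y') := by
        simp [mapLeft]
      have h2 (z z' : H) : coactLeft κ (z ⊗ₜ z') =
        TensorProduct.assoc ℚ H H H (κ z ⊗ₜ z') := rfl
      rw [h1, h2, h2, ← assoc_mapLeft, hκ, ← Algebra.TensorProduct.tmul_mul_tmul]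
      exact map_mul (Algebra.TensorProduct.assoc ℚ ℚ ℚ H H H) _ _

theorem deltaRight_mapLeft (Z : H ⊗[ℚ] H) :
    deltaRight Δ (mapLeft v H Z) = mapLeft v (H ⊗[ℚ] H) (deltaRight Δ Z) := by
  induction Z with
  | zero => simp
  | add a b ha hb => simp only [map_add, ha, hb]
  | tmul y y' => simp [deltaRight, mapLeft]

theorem deltaLeft_mapLeft (hΔ : ∀ x, Δ (v x) = 1 ⊗ₜ v x + mapLeft v H (κ x)) (Z : H ⊗[ℚ] H) :
    deltaLeft Δ (mapLeft v H Z) =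
      1 ⊗ₜ mapLeft v H Z + mapLeft v (H ⊗[ℚ] H) (coactLeft κ Z) := by
  induction Z with
  | zero => simp
  | add a b ha hb => simp only [map_add, ha, hb, TensorProduct.tmul_add]; abel
  | tmul y y' =>
    have h2 : coactLeft κ (y ⊗ₜ y') = TensorProduct.assoc ℚ H H H (κ y ⊗ₜ y') := rfl
    rw [h2, ← assoc_mapLeft]
    change TensorProduct.assoc ℚ H H H (Δ (v y) ⊗ₜ y') = _
    rw [hΔ, TensorProduct.add_tmul, map_add, TensorProduct.assoc_tmul]
    rfl

/-- Coassociativity on `v x` follows from the coaction identity on `x`. -/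
theorem deltaLeft_comul_apply (hΔ : ∀ x, Δ (v x) = 1 ⊗ₜ v x + mapLeft v H (κ x)) (x : H)
    (h : coactLeft κ (κ x) = deltaRight Δ (κ x)) :
    deltaLeft Δ (Δ (v x)) = deltaRight Δ (Δ (v x)) := by
  have h1 : deltaLeft Δ (1 ⊗ₜ v x) = 1 ⊗ₜ (1 ⊗ₜ v x) := by
    simp [deltaLeft, Algebra.TensorProduct.one_def]
  have h2 : deltaRight Δ (1 ⊗ₜ v x) = 1 ⊗ₜ Δ (v x) := by
    simp [deltaRight]
  rw [hΔ, map_add, map_add, h1, h2, deltaLeft_mapLeft hΔ, deltaRight_mapLeft, h, hΔ,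
    TensorProduct.tmul_add, add_assoc]

/-- If the coaction identity and coassociativity hold on `x`, and the coaction identity holds
on `y`, then both hold on `x * v y`. -/
theorem coassoc_mul (hΔ : ∀ x, Δ (v x) = 1 ⊗ₜ v x + mapLeft v H (κ x))
    (hκ : ∀ x y, κ (x * v y) = Δ x * mapLeft v H (κ y)) (x y : H)
    (hx : deltaLeft Δ (Δ x) = deltaRight Δ (Δ x))
    (hy : coactLeft κ (κ y) = deltaRight Δ (κ y)) :
    coactLeft κ (κ (x * v y)) = deltaRight Δ (κ (x * v y)) ∧
      deltaLeft Δ (Δ (x * v y)) = deltaRight Δ (Δ (x * v y)) := by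
  constructor
  · rw [hκ, coactLeft_mul hκ, map_mul, deltaRight_mapLeft, hx, hy]
  · rw [map_mul, map_mul, map_mul, hx, deltaLeft_comul_apply hΔ y hy]

theorem coassoc_one (h : κ 1 = 1) : coactLeft κ (κ 1) = deltaRight Δ (κ 1) ∧
      deltaLeft Δ (Δ 1) = deltaRight Δ (Δ 1) := by
  constructor
  · rw [h, map_one (deltaRight Δ)]
    simp [coactLeft, Algebra.TensorProduct.one_def, h]
  · rw [map_one, map_one, map_one]

end Coassoc

/-- For `l / V(r)`, coassociativity on `l` and the coaction identity on `r` give both conclusions,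
so the two must be proved together. -/
theorem coassoc_aux (u : Y) :
    coactLeft coact (coact (ncTree u)) = deltaRight ncDelta (coact (ncTree u)) ∧
      deltaLeft ncDelta (ncDelta (ncTree u)) = deltaRight ncDelta (ncDelta (ncTree u)) := by
  induction u with
  | nil =>
    refine coassoc_one ?_
    rw [← ncTree_nil, coact_ncTree, coactTree_nil]
  | node x a r ha hr =>
    cases x
    rw [ncTree_node, ← linV_ncTree]
    exact coassoc_mul ncDelta_linV coact_mul_linV _ _ ha.2 hr.1

theorem ncDelta_coassoc : (Algebra.TensorProduct.assoc ℚ ℚ ℚ Hnc Hnc Hnc).toAlgHom.comp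
      ((Algebra.TensorProduct.map ncDelta (.id ℚ Hnc)).comp ncDelta) =
    (Algebra.TensorProduct.map (.id ℚ Hnc) ncDelta).comp ncDelta :=
  Hnc_algHom_ext fun u => (coassoc_aux (V u)).2

theorem ncEps_ncTree_node (l r : Y) : ncEps (ncTree (.node () l r)) = 0 := by
  rw [ncEps, ncTree, MonoidAlgebra.lift_single, one_smul]
  rfl

theorem ncEps_V (t : Y) : ncEps (ncTree (V t)) = 0 := ncEps_ncTree_node .nil t

theorem ncEps_linV (x : Hnc) : ncEps (linV x) = 0 := by
  induction x using Hnc_induction with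
  | tree a => rw [linV_ncTree, ncEps_V]
  | add x z hx hz => simp only [map_add, hx, hz, add_zero]
  | smul c x hx => simp only [map_smul, hx, smul_zero]

theorem ncDelta_rTensor : (Algebra.TensorProduct.map ncEps (.id ℚ Hnc)).comp ncDelta =
    (Algebra.TensorProduct.lid ℚ Hnc).symm := by
  refine Hnc_algHom_ext fun t => ?_
  -- The counit kills the image of `V`, so only the term `1 ⊗ V(t)` survives.
  have h (Z : Hnc ⊗[ℚ] Hnc) : Algebra.TensorProduct.map ncEps (.id ℚ Hnc)
      (TensorProduct.map linV LinearMap.id Z) = 0 := by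
    induction Z with
    | zero => simp
    | add a b ha hb => simp only [map_add, ha, hb, add_zero]
    | tmul y y' => simp [ncEps_linV]
  rw [AlgHom.comp_apply, ncDelta_V, map_add, h]
  simp

/-- The right counit law on `V(r)` reduces to the same law for the coaction on `r`, hence the
simultaneous induction. -/
theorem counit_aux (u : Y) :
    Algebra.TensorProduct.map (.id ℚ Hnc) ncEps (coactTree u) = ncTree u ⊗ₜ 1 ∧
    Algebra.TensorProduct.map (.id ℚ Hnc) ncEps (ncDelta (ncTree u)) = ncTree u ⊗ₜ 1 := by
  have h (Z : Hnc ⊗[ℚ] Hnc) : Algebra.TensorProduct.map (.id ℚ Hnc) ncEps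
      (TensorProduct.map linV LinearMap.id Z) = TensorProduct.map linV LinearMap.id
        (Algebra.TensorProduct.map (.id ℚ Hnc) ncEps Z) := by
    induction Z with
    | zero => simp
    | add a b ha hb => simp only [map_add, ha, hb]
    | tmul y y' => simp
  induction u with
  | nil => simp [coactTree_nil, ncTree_nil, Algebra.TensorProduct.one_def]
  | node x a r ha hr =>
    cases x
    constructor
    · rw [coactTree_node_eq, map_mul, ha.2, h, hr.1]
      simp [linV_ncTree, ncTree_node]
    · rw [ncTree_node, map_mul, map_mul, ha.2, ncDelta_V, map_add, h, hr.1]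
      simp [ncEps_V, linV_ncTree]

theorem ncDelta_lTensor : (Algebra.TensorProduct.map (.id ℚ Hnc) ncEps).comp ncDelta =
    (Algebra.TensorProduct.rid ℚ ℚ Hnc).symm :=
  Hnc_algHom_ext fun u => (counit_aux (V u)).2

/-! ### The antipode of a connected graded bialgebra -/

section Antipode

variable {H : Type} [Ring H] [Bialgebra ℚ H] {gr : ℕ → Submodule ℚ H}

open WithConv Coalgebra

/-- The coproduct of an element of degree `n` is a sum of tensors of bidegrees `(i, j)` with `i + j
= n`, so a convolution product in degree `n` only sees its factors in these degrees. -/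
theorem conv_congr_of_mem
    (hΔ : ∀ n, ∀ x ∈ gr n, comul (R := ℚ) x ∈ ⨆ p : {p : ℕ × ℕ // p.1 + p.2 = n},
      LinearMap.range (TensorProduct.map (gr p.1.1).subtype (gr p.1.2).subtype))
    {f f' g g' : WithConv (H →ₗ[ℚ] H)} {n : ℕ}
    (h : ∀ i j, i + j = n → ∀ x ∈ gr i, ∀ y ∈ gr j, f x * g y = f' x * g' y) {x : H}
    (hx : x ∈ gr n) : (f * g) x = (f' * g') x := by
  have hle : (⨆ p : {p : ℕ × ℕ // p.1 + p.2 = n},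
      LinearMap.range (TensorProduct.map (gr p.1.1).subtype (gr p.1.2).subtype)) ≤
      LinearMap.eqLocus (LinearMap.mul' ℚ H ∘ₗ TensorProduct.map f.ofConv g.ofConv)
        (LinearMap.mul' ℚ H ∘ₗ TensorProduct.map f'.ofConv g'.ofConv) := by
    refine iSup_le fun p => ?_
    rintro _ ⟨z, rfl⟩
    induction z with
    | zero => simp
    | add a b ha hb => rw [map_add]; exact Submodule.add_mem _ ha hb
    | tmul a b => exact h _ _ p.2 a a.2 b b.2
  exact hle (hΔ n x hx)

theorem conv_pow_eq_zero_of_mem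
    (hΔ : ∀ n, ∀ x ∈ gr n, comul (R := ℚ) x ∈ ⨆ p : {p : ℕ × ℕ // p.1 + p.2 = n},
      LinearMap.range (TensorProduct.map (gr p.1.1).subtype (gr p.1.2).subtype))
    {g : WithConv (H →ₗ[ℚ] H)} (h0 : ∀ x ∈ gr 0, g x = 0) {k n : ℕ} (hk : n < k) {x : H}
    (hx : x ∈ gr n) : (g ^ k) x = 0 := by
  induction k generalizing n x with
  | zero => omega
  | succ k ih =>
    rw [pow_succ', conv_congr_of_mem hΔ (f' := 0) (g' := 0) ?_ hx, zero_mul]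
    · rfl
    intro i j hij y hy z hz
    -- Either `g` meets degree `0`, where it vanishes, or `g ^ k` meets a degree below `n`, hence
    -- below `k`.
    rcases Nat.eq_zero_or_pos i with rfl | hi
    · rw [h0 y hy]; simp
    · rw [ih (by omega) hz]; simp

/-- The map `g = 1 - Id`, with `1` the convolution unit, vanishes in degree `0`, so `g ^ k` vanishes
in degrees below `k`. The inverse of `Id = 1 - g` is therefore the geometric series in `g`, a finite
sum in each degree. -/
theorem exists_antipode
    (hint : DirectSum.IsInternal gr)
    (hΔ : ∀ n, ∀ x ∈ gr n, comul (R := ℚ) x ∈ ⨆ p : {p : ℕ × ℕ // p.1 + p.2 = n},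
      LinearMap.range (TensorProduct.map (gr p.1.1).subtype (gr p.1.2).subtype))
    (h0 : gr 0 = Submodule.span ℚ {1}) :
    ∃ S : WithConv (H →ₗ[ℚ] H), S * toConv LinearMap.id = 1 ∧ toConv LinearMap.id * S = 1 := by
  set i : WithConv (H →ₗ[ℚ] H) := toConv LinearMap.id with hi
  set g : WithConv (H →ₗ[ℚ] H) := 1 - i with hg
  have hg0 : ∀ x ∈ gr 0, g x = 0 := by
    intro x hx
    rw [h0, Submodule.mem_span_singleton] at hx
    obtain ⟨c, rfl⟩ := hx
    change g.ofConv (c • 1) = 0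
    rw [map_smul]
    have : g.ofConv 1 = algebraMap ℚ H (counit (R := ℚ) (1 : H)) - 1 := rfl
    rw [this]
    simp
  have hpow {k n : ℕ} (hk : n < k) {x : H} (hx : x ∈ gr n) : (g ^ k) x = 0 :=
    conv_pow_eq_zero_of_mem hΔ hg0 hk hx
  let G (N : ℕ) : WithConv (H →ₗ[ℚ] H) := ∑ k ∈ Finset.range (N + 1), g ^ k
  have hG {N n : ℕ} (hn : n ≤ N) {x : H} (hx : x ∈ gr n) : G N x = G n x := by
    induction N, hn using Nat.le_induction with
    | base => rfl
    | succ N hN ih =>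
      rw [← ih]
      change (∑ k ∈ Finset.range (N + 1 + 1), g ^ k) x = _
      rw [Finset.sum_range_succ]
      change G N x + (g ^ (N + 1)) x = _
      rw [hpow (by omega) hx, add_zero]
  let e := LinearEquiv.ofBijective (DirectSum.coeLinearMap gr) hint
  -- In degree `n` the series is truncated after `g ^ n`, the later terms being zero there.
  let S : WithConv (H →ₗ[ℚ] H) := toConv
    (DirectSum.toModule ℚ ℕ H (fun n => (G n).ofConv ∘ₗ (gr n).subtype) ∘ₗ e.symm.toLinearMap)
  have hS {n : ℕ} {x : H} (hx : x ∈ gr n) : S x = G n x := by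
    have : e.symm x = DirectSum.lof ℚ ℕ (fun n => gr n) n ⟨x, hx⟩ := by
      rw [LinearEquiv.symm_apply_eq]
      exact (DirectSum.coeLinearMap_lof gr n ⟨x, hx⟩).symm
    change DirectSum.toModule ℚ ℕ H _ (e.symm x) = _
    rw [this, DirectSum.toModule_lof]
    rfl
  have hext {f f' : WithConv (H →ₗ[ℚ] H)} (h : ∀ n, ∀ x ∈ gr n, f x = f' x) : f = f' := by
    apply WithConv.ofConv_injective
    apply LinearMap.ext
    intro x
    have hx : x ∈ (⨆ n, gr n) := by rw [hint.submodule_iSup_eq_top]; trivial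
    have : (⨆ n, gr n) ≤ LinearMap.eqLocus f.ofConv f'.ofConv := iSup_le fun n y hy => h n y hy
    exact this hx
  have hi' : i = 1 - g := by rw [hg]; abel
  have hone (n : ℕ) (x : H) (hx : x ∈ gr n) :
      (1 - g ^ (n + 1) : WithConv (H →ₗ[ℚ] H)) x = (1 : WithConv (H →ₗ[ℚ] H)) x := by
    change (1 : WithConv (H →ₗ[ℚ] H)) x - (g ^ (n + 1)) x = _
    rw [hpow (by omega) hx, sub_zero]
  refine ⟨S, hext fun n x hx => ?_, hext fun n x hx => ?_⟩
  · rw [conv_congr_of_mem hΔ (f' := G n) (g' := i) _ hx, hi', geom_sum_mul_neg, hone n x hx]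
    intro a b hab y hy z hz
    rw [hS hy, ← hG (N := n) (by omega) hy]
  · rw [conv_congr_of_mem hΔ (f' := i) (g' := G n) _ hx, hi', mul_neg_geom_sum, hone n x hx]
    intro a b hab y hy z hz
    rw [hS hz, ← hG (N := n) (by omega) hz]

end Antipode

/-! ### Hopf algebras from connected graded bialgebras, and their character groups -/

/-- `Δ` and `ε` satisfy the axioms of a bialgebra. -/
structure IsBialg {H : Type} [Ring H] [Algebra ℚ H] (Δ : H →ₐ[ℚ] H ⊗[ℚ] H) (ε : H →ₐ[ℚ] ℚ) :
    Prop where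
  coassoc : (Algebra.TensorProduct.assoc ℚ ℚ ℚ H H H).toAlgHom.comp
      ((Algebra.TensorProduct.map Δ (.id ℚ H)).comp Δ) =
    (Algebra.TensorProduct.map (.id ℚ H) Δ).comp Δ
  rTensor : (Algebra.TensorProduct.map ε (.id ℚ H)).comp Δ = (Algebra.TensorProduct.lid ℚ H).symm
  lTensor : (Algebra.TensorProduct.map (.id ℚ H) ε).comp Δ = (Algebra.TensorProduct.rid ℚ ℚ H).symm

section

variable {H : Type}

theorem IsBialg.exists_hopfAlgebra [Ring H] [Algebra ℚ H] {Δ : H →ₐ[ℚ] H ⊗[ℚ] H}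
    {ε : H →ₐ[ℚ] ℚ} {gr : ℕ → Submodule ℚ H} (h : IsBialg Δ ε) (hg : IsGradedConnected Δ ε gr) :
    ∃ hopf : HopfAlgebra ℚ H, hopf.toBialgebra =
      Bialgebra.ofAlgHom Δ ε h.coassoc h.rTensor h.lTensor := by
  let b : Bialgebra ℚ H := Bialgebra.ofAlgHom Δ ε h.coassoc h.rTensor h.lTensor
  obtain ⟨S, h1, h2⟩ := exists_antipode hg.decomposition hg.comul_mem hg.connected
  exact ⟨{ b with
    antipode := S.ofConv
    mul_antipode_rTensor_comul := congrArg WithConv.ofConv h1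
    mul_antipode_lTensor_comul := congrArg WithConv.ofConv h2 }, rfl⟩

theorem IsBialg.isHopf [Ring H] [Algebra ℚ H] {Δ : H →ₐ[ℚ] H ⊗[ℚ] H}
    {ε : H →ₐ[ℚ] ℚ} {gr : ℕ → Submodule ℚ H} (h : IsBialg Δ ε) (hg : IsGradedConnected Δ ε gr) :
    IsHopf Δ ε :=
  ⟨h.coassoc, h.rTensor, h.lTensor, h.exists_hopfAlgebra hg⟩

/-- The inverse of a character is its composite with the antipode, which is an algebra morphism
since `H` is commutative. -/
theorem exists_group_algHom [CommRing H] [HopfAlgebra ℚ H] (A : Type*) [CommRing A] [Algebra ℚ A] :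
    ∃ _ : Group (H →ₐ[ℚ] A),
      (∀ χ ψ : H →ₐ[ℚ] A, χ * ψ = convMul (Bialgebra.comulAlgHom ℚ H) χ ψ) ∧
      (1 : H →ₐ[ℚ] A) = (Algebra.ofId ℚ A).comp (Bialgebra.counitAlgHom ℚ H) := by
  have hinv (f : WithConv (H →ₐ[ℚ] A)) :
      WithConv.toConv (f.ofConv.comp (HopfAlgebra.antipodeAlgHom ℚ H)) * f = 1 := by
    have h := AlgHom.comp_convMul_distrib f.ofConv
      (WithConv.toConv (HopfAlgebra.antipodeAlgHom ℚ H)) (WithConv.toConv (AlgHom.id ℚ H))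
    rw [AlgHom.antipode_id_cancel] at h
    apply WithConv.ofConv_injective
    refine Eq.trans ?_ (h.symm.trans ?_)
    · rfl
    · ext x
      simp [AlgHom.convOne_def]
  let grp : Group (WithConv (H →ₐ[ℚ] A)) :=
    { (inferInstance : Monoid (WithConv (H →ₐ[ℚ] A))) with
      inv := fun f => WithConv.toConv (f.ofConv.comp (HopfAlgebra.antipodeAlgHom ℚ H))
      inv_mul_cancel := hinv }
  exact ⟨(WithConv.equiv (H →ₐ[ℚ] A)).symm.group,
    fun χ ψ => AlgHom.ext fun x => AlgHom.convMul_apply (WithConv.toConv χ) (WithConv.toConv ψ) x,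
    rfl⟩

theorem IsBialg.exists_group_algHom [CommRing H] [Algebra ℚ H] {Δ : H →ₐ[ℚ] H ⊗[ℚ] H}
    {ε : H →ₐ[ℚ] ℚ} {gr : ℕ → Submodule ℚ H} (h : IsBialg Δ ε) (hg : IsGradedConnected Δ ε gr)
    (A : Type*) [CommRing A] [Algebra ℚ A] :
    ∃ _ : Group (H →ₐ[ℚ] A), (∀ χ ψ : H →ₐ[ℚ] A, χ * ψ = convMul Δ χ ψ) ∧
      (1 : H →ₐ[ℚ] A) = (Algebra.ofId ℚ A).comp ε := by
  let b : Bialgebra ℚ H := Bialgebra.ofAlgHom Δ ε h.coassoc h.rTensor h.lTensor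
  obtain ⟨S, h1, h2⟩ := exists_antipode hg.decomposition hg.comul_mem hg.connected
  exact @QEDCharge.exists_group_algHom H _ { b with
    antipode := S.ofConv
    mul_antipode_rTensor_comul := congrArg WithConv.ofConv h1
    mul_antipode_lTensor_comul := congrArg WithConv.ofConv h2 } A _ _

/-- The group structure on characters is transported along the representing bijection; stability
under change of scalars is its naturality. -/
theorem IsBialg.isGroupFunctor [CommRing H] [Algebra ℚ H] {Δ : H →ₐ[ℚ] H ⊗[ℚ] H}
    {ε : H →ₐ[ℚ] ℚ} {gr : ℕ → Submodule ℚ H} (h : IsBialg Δ ε) (hg : IsGradedConnected Δ ε gr)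
    {c : Y → H} {G : ∀ (A : Type u) [CommRing A] [Algebra ℚ A], Set (Y → A)}
    (hr : IsRepresentedBy Δ ε c G) : IsGroupFunctor G where
  group A _ _ := by
    obtain ⟨_, hmul, hone⟩ := h.exists_group_algHom hg A
    let e : G A ≃ (H →ₐ[ℚ] A) := ((Equiv.Set.univ _).symm.trans (hr.bijOn A).equiv).symm
    have he (χ : H →ₐ[ℚ] A) : (e.symm χ : Y → A) = pointSeries c χ := rfl
    refine ⟨e.group, fun φ ψ => ?_, ?_⟩
    · change (e.symm (e φ * e ψ) : Y → A) = _
      rw [he, hmul, hr.map_conv, ← he, ← he, e.symm_apply_apply, e.symm_apply_apply]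
    · change (e.symm 1 : Y → A) = _
      rw [he, ← hr.map_counit A, hone]
  map_mem A B _ _ _ _ f φ hφ := by
    obtain ⟨χ, -, rfl⟩ := (hr.bijOn A).surjOn hφ
    dsimp only
    rw [← hr.natural A B f χ]
    exact (hr.bijOn B).mapsTo (Set.mem_univ _)
  map_comp A B _ _ _ _ f φ _ ψ _ := funext fun t => map_comp_series f.toRingHom φ ψ t

end

/-! ### The commutative charge algebra as a quotient of `ℚY` -/

theorem abProj_ncTree (t : Y) : abProj (ncTree t) = alphaTree t := by
  rw [abProj, ncTree, MonoidAlgebra.lift_single, one_smul]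
  rfl

theorem alphaTree_nil : alphaTree .nil = 1 := rfl

theorem alphaTree_mul (s t : Y) : alphaTree (s * t) = alphaTree s * alphaTree t :=
  map_mul alphaTreeHom s t

theorem alphaTree_V (t : Y) : alphaTree (V t) = MvPolynomial.X t := one_mul _

theorem alphaTree_node (l r : Y) : alphaTree (.node () l r) = alphaTree l * MvPolynomial.X r := rfl

theorem alphaTree_list_prod (L : List Y) : alphaTree L.prod = (L.map alphaTree).prod :=
  map_list_prod alphaTreeHom L

theorem ncTree_list_prod (L : List Y) : ncTree L.prod = (L.map ncTree).prod :=
  map_list_prod (MonoidAlgebra.of ℚ Y) L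

theorem map_abProj_comp_ncDelta :
    (Algebra.TensorProduct.map abProj abProj).comp ncDelta = alphaDelta.comp abProj := by
  refine Hnc_algHom_ext fun t => ?_
  have h : ncDelta (ncTree (V t)) = 1 ⊗ₜ ncTree (V t) + ncDeltaV t := by
    rw [ncDelta_V, ← (deltaPair_eq t).2]
    rfl
  rw [AlgHom.comp_apply, AlgHom.comp_apply, h, abProj_ncTree, alphaTree_V, alphaDelta,
    MvPolynomial.aeval_X, map_add, Algebra.TensorProduct.map_tmul, map_one, abProj_ncTree]
  rfl

theorem alphaEps_comp_abProj : alphaEps.comp abProj = ncEps := by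
  refine Hnc_algHom_ext fun t => ?_
  rw [AlgHom.comp_apply, abProj_ncTree, alphaTree_V, ncEps_V, alphaEps, MvPolynomial.aeval_X]

theorem abProj_surjective : Function.Surjective abProj := by
  intro x
  induction x using MvPolynomial.induction_on with
  | C a => exact ⟨algebraMap ℚ _ a, by rw [AlgHom.commutes]; rfl⟩
  | add p q hp hq =>
    obtain ⟨y, rfl⟩ := hp
    obtain ⟨z, rfl⟩ := hq
    exact ⟨y + z, map_add ..⟩
  | mul_X p t hp =>
    obtain ⟨y, rfl⟩ := hp
    exact ⟨y * ncTree (V t), by rw [map_mul, abProj_ncTree, alphaTree_V]⟩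

/-- Each axiom for `K` compares two morphisms out of `K`. Composed with the surjection `π`, they
become images of the two sides of the axiom for `H`. -/
theorem IsBialg.of_surjective {H K : Type} [Ring H] [Algebra ℚ H] [Ring K] [Algebra ℚ K]
    {Δ : H →ₐ[ℚ] H ⊗[ℚ] H} {ε : H →ₐ[ℚ] ℚ} {Δ' : K →ₐ[ℚ] K ⊗[ℚ] K} {ε' : K →ₐ[ℚ] ℚ}
    (h : IsBialg Δ ε) (π : H →ₐ[ℚ] K) (hπ : Function.Surjective π)
    (hΔ : (Algebra.TensorProduct.map π π).comp Δ = Δ'.comp π) (hε : ε'.comp π = ε) :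
    IsBialg Δ' ε' := by
  have hΔ' (x : H) : Δ' (π x) = Algebra.TensorProduct.map π π (Δ x) := (DFunLike.congr_fun hΔ x).symm
  have hε' (x : H) : ε' (π x) = ε x := DFunLike.congr_fun hε x
  constructor
  · rw [← AlgHom.cancel_right hπ]
    ext x
    have e1 (z : H ⊗[ℚ] H) (y : H) : TensorProduct.assoc ℚ K K K
        (Algebra.TensorProduct.map π π z ⊗ₜ π y) =
        Algebra.TensorProduct.map π (Algebra.TensorProduct.map π π)
          (TensorProduct.assoc ℚ H H H (z ⊗ₜ y)) := by
      induction z with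
      | zero => simp
      | tmul a b => simp
      | add a b ha hb => simp only [map_add, TensorProduct.add_tmul, ha, hb]
    have e2 (z : H ⊗[ℚ] H) : deltaLeft Δ' (Algebra.TensorProduct.map π π z) =
        Algebra.TensorProduct.map π (Algebra.TensorProduct.map π π) (deltaLeft Δ z) := by
      induction z with
      | zero => simp
      | tmul a b =>
        change TensorProduct.assoc ℚ K K K (Δ' (π a) ⊗ₜ π b) = _
        rw [hΔ', e1]
        rfl
      | add a b ha hb => simp only [map_add, ha, hb]
    have e3 (z : H ⊗[ℚ] H) : deltaRight Δ' (Algebra.TensorProduct.map π π z) =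
        Algebra.TensorProduct.map π (Algebra.TensorProduct.map π π) (deltaRight Δ z) := by
      induction z with
      | zero => simp
      | tmul a b => simp [deltaRight, hΔ']
      | add a b ha hb => simp only [map_add, ha, hb]
    change deltaLeft Δ' (Δ' (π x)) = deltaRight Δ' (Δ' (π x))
    rw [hΔ', e2, e3]
    exact congrArg _ (DFunLike.congr_fun h.coassoc x)
  · rw [← AlgHom.cancel_right hπ]
    ext x
    have e (z : H ⊗[ℚ] H) : Algebra.TensorProduct.map ε' (.id ℚ K)
        (Algebra.TensorProduct.map π π z) = Algebra.TensorProduct.map (.id ℚ ℚ) π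
          (Algebra.TensorProduct.map ε (.id ℚ H) z) := by
      induction z with
      | zero => simp
      | tmul a b => simp [hε']
      | add a b ha hb => simp only [map_add, ha, hb]
    have hx := DFunLike.congr_fun h.rTensor x
    simp only [AlgHom.comp_apply] at hx ⊢
    rw [hΔ', e, hx]
    simp
  · rw [← AlgHom.cancel_right hπ]
    ext x
    have e (z : H ⊗[ℚ] H) : Algebra.TensorProduct.map (.id ℚ K) ε'
        (Algebra.TensorProduct.map π π z) = Algebra.TensorProduct.map π (.id ℚ ℚ)
          (Algebra.TensorProduct.map (.id ℚ H) ε z) := by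
      induction z with
      | zero => simp
      | tmul a b => simp [hε']
      | add a b ha hb => simp only [map_add, ha, hb]
    have hx := DFunLike.congr_fun h.lTensor x
    simp only [AlgHom.comp_apply] at hx ⊢
    rw [hΔ', e, hx]
    simp

theorem isBialg_nc : IsBialg ncDelta ncEps := ⟨ncDelta_coassoc, ncDelta_rTensor, ncDelta_lTensor⟩

theorem isBialg_alpha : IsBialg alphaDelta alphaEps :=
  isBialg_nc.of_surjective abProj abProj_surjective map_abProj_comp_ncDelta alphaEps_comp_abProj

theorem alphaDelta_alphaTree (u : Y) : alphaDelta (alphaTree u) = 1 ⊗ₜ alphaTree u +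
    ∑ p ∈ rhoDecomp u, alphaTree p.1 ⊗ₜ ((p.2.1.map alphaTree).prod * alphaTree p.2.2) := by
  have h := DFunLike.congr_fun map_abProj_comp_ncDelta (ncTree u)
  rw [AlgHom.comp_apply, AlgHom.comp_apply, abProj_ncTree] at h
  rw [← h, ncDelta_ncTree_eq_sum]
  simp [map_sum, abProj_ncTree, map_list_prod, Function.comp_def]

theorem ncDelta_V_eq_sum (u : Y) : ncDelta (ncTree (V u)) = 1 ⊗ₜ ncTree (V u) +
    ∑ p ∈ alphaDecomp u, ncTree (V p.1) ⊗ₜ[ℚ] (p.2.map ncTree).prod := by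
  rw [ncDelta_V, map_linV_coactTree]

theorem alphaDelta_V_eq_sum (u : Y) : alphaDelta (alphaTree (V u)) = 1 ⊗ₜ alphaTree (V u) +
    ∑ p ∈ alphaDecomp u, alphaTree (V p.1) ⊗ₜ[ℚ] (p.2.map alphaTree).prod := by
  have h := DFunLike.congr_fun map_abProj_comp_ncDelta (ncTree (V u))
  rw [AlgHom.comp_apply, AlgHom.comp_apply, abProj_ncTree] at h
  rw [← h, ncDelta_V_eq_sum]
  simp [map_sum, abProj_ncTree, map_list_prod, Function.comp_def]

/-! ### The bialgebra `Hrho` and the group law of `Grho` -/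

theorem rhoTree_nil : rhoTree .nil = 1 := dif_pos rfl

theorem rhoTree_of_ne {t : Y} (h : t ≠ .nil) : rhoTree t = MvPolynomial.X ⟨t, h⟩ := dif_neg h

/-- The coproduct is the product, under `rhoMul`, of the generic series with coefficients `t ⊗ 1`
and `1 ⊗ t`, and `F` specialises these. Different choices of `F` give coassociativity, the counit
laws, the compatibility with `R` and the convolution of characters. -/
theorem comp_rhoDelta {B : Type*} [CommRing B] [Algebra ℚ B] (F : Hrho ⊗[ℚ] Hrho →ₐ[ℚ] B) (u : Y) :
    F (rhoDelta (rhoTree u)) =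
      rhoMul (fun t => F (rhoTree t ⊗ₜ 1)) (fun t => F (1 ⊗ₜ rhoTree t)) u := by
  by_cases hu : u = .nil
  · subst hu
    rw [rhoMul_nil, rhoTree_nil, map_one, map_one, ← Algebra.TensorProduct.one_def, map_one, one_mul]
  · have hL (L : List Y) : F (1 ⊗ₜ (L.map rhoTree).prod) =
        (L.map fun t => F (1 ⊗ₜ rhoTree t)).prod := by
      have := map_list_prod (F.comp (Algebra.TensorProduct.includeRight (R := ℚ)
        (A := Hrho) (B := Hrho))) (L.map rhoTree)
      rw [List.map_map] at this
      exact this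
    rw [rhoMul, substOver_eq_sum, rhoTree_nil, ← Algebra.TensorProduct.one_def, map_one, one_mul]
    conv_lhs => rw [rhoTree_of_ne hu, rhoDelta, MvPolynomial.aeval_X]
    rw [map_add, map_sum]
    congr 1
    refine Finset.sum_congr rfl fun p _ => ?_
    have e : rhoTree p.1 ⊗ₜ[ℚ] ((p.2.1.map rhoTree).prod * rhoTree p.2.2) =
        (rhoTree p.1 ⊗ₜ 1) * ((1 ⊗ₜ (p.2.1.map rhoTree).prod) * (1 ⊗ₜ rhoTree p.2.2)) := by simp
    rw [e, map_mul, map_mul, hL]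

/-- The coordinate `x^nil` stands for `x^nil / x^vtx = x^vtx`, the unit for composition. -/
theorem subst_xpow_nil {A : Type*} [CommRing A] (u : Y) :
    (∀ φ : Y → A, subst (xpow .nil) u φ = φ u) ∧
      ∀ φ : Y → A, substOver (xpow .nil) (xpow .nil) u φ = φ u := by
  induction u with
  | nil => constructor <;> intro φ <;> simp [subst_nil, substOver_nil, xpow]
  | node x a r ha hr =>
    cases x
    have h (φ : Y → A) : subst (xpow .nil) (.node () a r) φ = φ (.node () a r) := by
      rw [subst_node, ha.2, hr.1]
    refine ⟨h, fun φ => ?_⟩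
    rw [substOver_node, h]
    simp [xpow, substOver]

theorem rhoMul_xpow_nil {A : Type*} [CommRing A] (f : Y → A) : rhoMul f (xpow .nil) = f :=
  funext fun u => (subst_xpow_nil u).2 f

theorem xpow_nil_rhoMul {A : Type*} [CommRing A] (g : Y → A) : rhoMul (xpow .nil) g = g := by
  ext u
  rw [rhoMul, substOver_eq_sum, Finset.sum_eq_zero]
  · simp [xpow]
  · intro p hp
    simp [xpow, (mem_rhoDecomp.1 hp).1]

theorem rhoEps_rhoTree (t : Y) : rhoEps (rhoTree t) = xpow .nil t := by
  by_cases h : t = .nil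
  · simp [h, rhoTree_nil, xpow]
  · rw [rhoTree_of_ne h, rhoEps, MvPolynomial.aeval_X, xpow, if_neg h]

theorem Hrho_algHom_ext {B : Type*} [CommSemiring B] [Algebra ℚ B] {f g : Hrho →ₐ[ℚ] B}
    (h : ∀ t, f (rhoTree t) = g (rhoTree t)) : f = g := by
  refine MvPolynomial.algHom_ext fun t => ?_
  rw [← rhoTree_of_ne t.2, h]

/-- The two iterated coproducts are the two bracketings of the product of the generic series `c ⊗ 1
⊗ 1`, `1 ⊗ c ⊗ 1` and `1 ⊗ 1 ⊗ c`, so `rhoMul_assoc` applies. -/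
theorem deltaLeft_eq_deltaRight_of_rhoMul {H : Type} [CommRing H] [Algebra ℚ H]
    {Δ : H →ₐ[ℚ] H ⊗[ℚ] H} {c : Y → H}
    (hc : ∀ u, Δ (c u) = rhoMul (fun t => c t ⊗ₜ 1) (fun t => 1 ⊗ₜ c t) u) (u : Y) :
    deltaLeft Δ (Δ (c u)) = deltaRight Δ (Δ (c u)) := by
  let iR : H ⊗[ℚ] H →ₐ[ℚ] H ⊗[ℚ] (H ⊗[ℚ] H) := Algebra.TensorProduct.includeRight
  let iL : H ⊗[ℚ] H →ₐ[ℚ] H ⊗[ℚ] (H ⊗[ℚ] H) :=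
    (Algebra.TensorProduct.assoc ℚ ℚ ℚ H H H).toAlgHom.comp Algebra.TensorProduct.includeLeft
  have key (F : H ⊗[ℚ] H →ₐ[ℚ] H ⊗[ℚ] (H ⊗[ℚ] H)) (u : Y) : F (Δ (c u)) =
      rhoMul (fun t => F (c t ⊗ₜ 1)) (fun t => F (1 ⊗ₜ c t)) u := by
    rw [hc]
    exact map_rhoMul F.toRingHom _ _ u
  have h1 : (fun t => deltaLeft Δ (c t ⊗ₜ 1)) =
      rhoMul (fun t => c t ⊗ₜ[ℚ] ((1 : H) ⊗ₜ[ℚ] (1 : H))) fun t => (1 : H) ⊗ₜ[ℚ] (c t ⊗ₜ[ℚ] (1 : H)) := by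
    ext1 t; exact key iL t
  have h2 : (fun t => deltaLeft Δ (1 ⊗ₜ c t)) = fun t => 1 ⊗ₜ (1 ⊗ₜ c t) := by
    ext1 t; simp [deltaLeft, Algebra.TensorProduct.one_def]
  have h3 : (fun t => deltaRight Δ (c t ⊗ₜ 1)) = fun t => c t ⊗ₜ (1 ⊗ₜ 1) := by
    ext1 t; simp [deltaRight, Algebra.TensorProduct.one_def]
  have h4 : (fun t => deltaRight Δ (1 ⊗ₜ c t)) =
      rhoMul (fun t => (1 : H) ⊗ₜ[ℚ] (c t ⊗ₜ[ℚ] (1 : H))) fun t => (1 : H) ⊗ₜ[ℚ] ((1 : H) ⊗ₜ[ℚ] c t) := by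
    ext1 t
    refine Eq.trans ?_ (key iR t)
    simp [deltaRight, iR]
  rw [key (deltaLeft Δ), key (deltaRight Δ), h1, h2, h3, h4, rhoMul_assoc]

theorem isBialg_rho : IsBialg rhoDelta rhoEps := by
  constructor
  · refine Hrho_algHom_ext (B := Hrho ⊗[ℚ] (Hrho ⊗[ℚ] Hrho)) fun u => ?_
    exact deltaLeft_eq_deltaRight_of_rhoMul (fun u => comp_rhoDelta (AlgHom.id ℚ _) u) u
  · refine Hrho_algHom_ext fun u => ?_
    have h1 : (fun t => Algebra.TensorProduct.map rhoEps (.id ℚ Hrho) (rhoTree t ⊗ₜ 1)) =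
        xpow .nil := by
      ext1 t
      by_cases h : t = .nil <;>
        simp [rhoEps_rhoTree, xpow, h, Algebra.TensorProduct.one_def]
    have := comp_rhoDelta (Algebra.TensorProduct.map rhoEps (.id ℚ Hrho)) u
    rw [h1, xpow_nil_rhoMul] at this
    refine this.trans ?_
    simp
  · refine Hrho_algHom_ext fun u => ?_
    have h1 : (fun t => Algebra.TensorProduct.map (.id ℚ Hrho) rhoEps (1 ⊗ₜ rhoTree t)) =
        xpow .nil := by
      ext1 t
      by_cases h : t = .nil <;>
        simp [rhoEps_rhoTree, xpow, h, Algebra.TensorProduct.one_def]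
    have := comp_rhoDelta (Algebra.TensorProduct.map (.id ℚ Hrho) rhoEps) u
    rw [h1, rhoMul_xpow_nil] at this
    refine this.trans ?_
    simp

theorem R_rhoTree (t : Y) : R (rhoTree t) = alphaTree t := by
  by_cases h : t = .nil
  · rw [h, rhoTree_nil, map_one, alphaTree_nil]
  · rw [rhoTree_of_ne h, R, MvPolynomial.aeval_X]

/-- On every tree, and not only on the generators `V(t)`, `alphaDelta` is given by the same sum as
`rhoDelta`; this is the image of the formula in `ℚY`. -/
theorem map_R_comp_rhoDelta :
    (Algebra.TensorProduct.map R R).comp rhoDelta = alphaDelta.comp R := by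
  refine Hrho_algHom_ext fun u => (comp_rhoDelta (Algebra.TensorProduct.map R R) u).trans ?_
  rw [AlgHom.comp_apply, R_rhoTree, alphaDelta_alphaTree, rhoMul, substOver_eq_sum]
  simp only [Algebra.TensorProduct.map_tmul, R_rhoTree, map_one, alphaTree_nil]
  rw [← Algebra.TensorProduct.one_def, one_mul]
  congr 1
  refine Finset.sum_congr rfl fun p _ => ?_
  have := map_list_prod (Algebra.TensorProduct.includeRight :
    Halpha →ₐ[ℚ] Halpha ⊗[ℚ] Halpha) (p.2.1.map alphaTree)
  rw [List.map_map] at this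
  rw [show (p.2.1.map fun t => (1 : Halpha) ⊗ₜ[ℚ] alphaTree t).prod = _ from this.symm]
  simp

theorem R_surjective : Function.Surjective R := by
  intro x
  induction x using MvPolynomial.induction_on with
  | C a => exact ⟨MvPolynomial.C a, AlgHom.commutes R a⟩
  | add p q hp hq =>
    obtain ⟨y, rfl⟩ := hp
    obtain ⟨z, rfl⟩ := hq
    exact ⟨y + z, map_add ..⟩
  | mul_X p t hp =>
    obtain ⟨y, rfl⟩ := hp
    exact ⟨y * rhoTree (V t), by rw [map_mul, R_rhoTree, alphaTree_V]⟩

theorem alphaEps_comp_R : alphaEps.comp R = rhoEps := by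
  refine Hrho_algHom_ext fun t => ?_
  have h := DFunLike.congr_fun alphaEps_comp_abProj (ncTree t)
  rw [AlgHom.comp_apply, abProj_ncTree] at h
  rw [AlgHom.comp_apply, R_rhoTree, h, rhoEps_rhoTree]
  cases t with
  | nil => simp [ncTree_nil, xpow]
  | node x l r => cases x; rw [ncEps_ncTree_node]; simp [xpow]

/-! ### The groups of points -/

theorem overMul_xpow_nil_vtx {A : Type*} [CommRing A] : overMul (xpow .nil) (xpow vtx) = (xpow vtx : Y → A) := by
  ext u
  cases u with
  | nil => rw [overMul_vtx_nil]; simp [xpow, vtx]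
  | node x a r =>
    rw [overMul_vtx_node]
    by_cases hr : r = .nil <;> simp [xpow, vtx, hr]

section Points

variable {A : Type u} [CommRing A] [Algebra ℚ A]

theorem convMul_rhoTree (χ ψ : Hrho →ₐ[ℚ] A) (u : Y) : convMul rhoDelta χ ψ (rhoTree u) =
    rhoMul (fun t => χ (rhoTree t)) (fun t => ψ (rhoTree t)) u := by
  refine (comp_rhoDelta (Algebra.TensorProduct.lift χ ψ fun _ _ => Commute.all _ _) u).trans ?_
  simp

theorem pointSeries_natural {B : Type u} [CommRing B] [Algebra ℚ B] {H : Type} [Ring H]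
    [Algebra ℚ H] (c : Y → H) (h : A →ₐ[ℚ] B) (χ : H →ₐ[ℚ] A) :
    pointSeries c (h.comp χ) = fun t => h (pointSeries c χ t) :=
  funext fun t => (map_overMul_vtx h.toRingHom (fun t => χ (c t)) t).symm

theorem pointSeries_rho_conv (χ ψ : Hrho →ₐ[ℚ] A) :
    pointSeries rhoTree (convMul rhoDelta χ ψ) =
      comp (pointSeries rhoTree χ) (pointSeries rhoTree ψ) := by
  rw [pointSeries, pointSeries, pointSeries, comp_overMul_vtx_overMul_vtx]
  congr 1
  exact funext fun t => convMul_rhoTree χ ψ t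

theorem pointSeries_comp_R (χ : Halpha →ₐ[ℚ] A) :
    pointSeries rhoTree (χ.comp R) = pointSeries alphaTree χ := by
  simp only [pointSeries, AlgHom.comp_apply, R_rhoTree]

theorem convMul_comp_R (χ ψ : Halpha →ₐ[ℚ] A) :
    convMul rhoDelta (χ.comp R) (ψ.comp R) = (convMul alphaDelta χ ψ).comp R := by
  rw [convMul, convMul, AlgHom.comp_assoc, ← map_R_comp_rhoDelta, ← AlgHom.comp_assoc]
  congr 1
  ext <;> simp

end Points

theorem rho_isRepresentedBy : IsRepresentedBy.{u} rhoDelta rhoEps rhoTree Grho where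
  bijOn A _ _ := by
    refine ⟨fun χ _ => ⟨_, by rw [rhoTree_nil, map_one], rfl⟩, fun χ _ ψ _ h => ?_, ?_⟩
    · exact Hrho_algHom_ext fun t => congrFun (overMul_vtx_injective h) t
    · rintro _ ⟨f, hf, rfl⟩
      refine ⟨MvPolynomial.aeval fun t => f t.1, Set.mem_univ _, ?_⟩
      dsimp only [pointSeries]
      congr 1
      ext t
      by_cases h : t = .nil
      · rw [h, rhoTree_nil, map_one, hf]
      · rw [rhoTree_of_ne h, MvPolynomial.aeval_X]
  map_conv A _ _ := pointSeries_rho_conv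
  map_counit A _ _ := by
    rw [← overMul_xpow_nil_vtx, pointSeries]
    congr 1
    ext t
    rw [AlgHom.comp_apply, rhoEps_rhoTree]
    by_cases h : t = .nil <;> simp [xpow, h]
  natural A B _ _ _ _ := pointSeries_natural rhoTree

/-! ### The series of `Galpha` as multiplicative series -/

section Galpha

variable {A : Type u} [CommRing A]

theorem overMul_nil (f g : Y → A) : overMul f g .nil = f .nil * g .nil := by
  simp [overMul, overPairs_nil]

theorem overMul_node (f g : Y → A) (a r : Y) : overMul f g (.node () a r) =
    f (.node () a r) * g .nil + overMul f (fun q => g (.node () q r)) a :=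
  sum_overPairs_node a r fun p => f p.1 * g p.2

theorem overMul_xpow_nil (f : Y → A) : overMul f (xpow .nil) = f := by
  ext u
  cases u with
  | nil => simp [overMul_nil, xpow]
  | node x a r =>
    cases x
    rw [overMul_node]
    simp [xpow, overMul]

theorem overMul_sub (f g h : Y → A) : overMul f (g - h) = overMul f g - overMul f h := by
  ext u
  simp [overMul, mul_sub]

theorem sub_overMul (f g h : Y → A) : overMul (f - g) h = overMul f h - overMul g h := by
  ext u
  simp [overMul, sub_mul]

theorem xpow_nil_overMul (f : Y → A) : overMul (xpow .nil) f = f := by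
  ext u
  induction u generalizing f with
  | nil => simp [overMul_nil, xpow]
  | node x a r ih =>
    cases x
    rw [overMul_node, ih]
    simp [xpow]

theorem underMul_vtx_nil (f : Y → A) : underMul (xpow vtx) f .nil = 0 := by
  refine Finset.sum_eq_zero fun p hp => ?_
  rw [mem_underPairs] at hp
  have : p.1 ≠ vtx := by
    intro h
    rw [h] at hp
    simp [vtx, graftUnder] at hp
  simp [xpow, this]

theorem underMul_vtx_node (f : Y → A) (a r : Y) :
    underMul (xpow vtx) f (.node () a r) = if a = .nil then f r else 0 := by
  split_ifs with h
  · subst h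
    rw [underMul, Finset.sum_eq_single (vtx, r)]
    · simp [xpow]
    · rintro ⟨p, q⟩ hp hne
      rw [mem_underPairs] at hp
      have : p ≠ vtx := by
        rintro rfl
        refine hne ?_
        simpa [vtx, graftUnder] using hp
      simp [xpow, this]
    · intro hn
      simp [mem_underPairs, vtx, graftUnder] at hn
  · refine Finset.sum_eq_zero fun p hp => ?_
    rw [mem_underPairs] at hp
    have : p.1 ≠ vtx := by
      intro h'
      rw [h'] at hp
      simp only [vtx, graftUnder, BinaryTree.node.injEq] at hp
      exact h hp.2.1.symm
    simp [xpow, this]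

/-- `f ↦ f · (x^vtx \ h)` lowers trees by their last factor. -/
theorem overMul_underMul_vtx_node (g f : Y → A) (a r : Y) :
    overMul g (underMul (xpow vtx) f) (.node () a r) = g a * f r := by
  rw [overMul_node, underMul_vtx_nil, mul_zero, zero_add]
  simp only [underMul_vtx_node]
  have : (fun q : Y => if q = .nil then f r else 0) = fun q => xpow .nil q * f r := by
    ext q; simp [xpow]
  rw [this]
  conv_rhs => rw [← overMul_xpow_nil g]
  simp [overMul, Finset.sum_mul, mul_assoc]

/-- Comparing coefficients of `x^{a / V(r)}` gives the recursion. Its solution is multiplicative: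
the coefficient of `V(t₁) / ⋯ / V(t_n)` in `g` is `f_{t₁} ⋯ f_{t_n}`. -/
theorem overMul_right_inv_iff (f g : Y → A) :
    overMul g (xpow .nil - underMul (xpow vtx) f) = xpow .nil ↔
      g .nil = 1 ∧ ∀ a r, g (.node () a r) = g a * f r := by
  rw [overMul_sub, overMul_xpow_nil]
  constructor
  · intro h
    refine ⟨?_, fun a r => ?_⟩
    · have := congrFun h .nil
      simpa [overMul_nil, underMul_vtx_nil, xpow] using this
    · have := congrFun h (.node () a r)
      rw [Pi.sub_apply, overMul_underMul_vtx_node] at this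
      simpa [xpow, sub_eq_zero] using this
  · rintro ⟨h1, h2⟩
    ext u
    cases u with
    | nil => simp [overMul_nil, underMul_vtx_nil, h1, xpow]
    | node x a r =>
      cases x
      rw [Pi.sub_apply, overMul_underMul_vtx_node, h2]
      simp [xpow]

theorem overMul_left_inv (f g : Y → A) (h1 : g .nil = 1)
    (h2 : ∀ a r, g (.node () a r) = g a * f r) :
    overMul (xpow .nil - underMul (xpow vtx) f) g = xpow .nil := by
  -- Removing the last factor `V(r)` divides both sides by the common factor `f r`, formally, until
  -- a single factor is left.
  have key : ∀ u : Y, u ≠ .nil → overMul (underMul (xpow vtx) f) g u = g u := by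
    intro u
    induction u with
    | nil => intro h; exact absurd rfl h
    | node x a r ih =>
      cases x
      intro _
      rw [overMul_node, h1, mul_one, h2, underMul_vtx_node]
      simp only [h2]
      have h3 : overMul (underMul (xpow vtx) f) (fun q => g q * f r) a =
          overMul (underMul (xpow vtx) f) g a * f r := by
        simp [overMul, Finset.sum_mul, mul_assoc]
      rw [h3]
      by_cases ha : a = .nil
      · simp [ha, overMul_nil, underMul_vtx_nil, h1]
      · rw [ih ha, if_neg ha, zero_add]
  rw [sub_overMul, xpow_nil_overMul]
  ext u
  by_cases hu : u = .nil
  · simp [hu, overMul_nil, underMul_vtx_nil, h1, xpow]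
  · simp [key u hu, xpow, hu]

end Galpha

theorem alpha_isRepresentedBy : IsRepresentedBy.{u} alphaDelta alphaEps alphaTree Galpha where
  bijOn A _ _ := by
    refine ⟨fun χ _ => ?_, fun χ _ ψ _ h => ?_, ?_⟩
    · have h1 : χ (alphaTree .nil) = 1 := map_one χ
      have h2 (a r : Y) : χ (alphaTree (.node () a r)) =
        χ (alphaTree a) * χ (MvPolynomial.X r) := map_mul χ _ _
      exact ⟨fun t => χ (MvPolynomial.X t), fun t => χ (alphaTree t),
        overMul_left_inv _ _ h1 h2, (overMul_right_inv_iff _ _).2 ⟨h1, h2⟩, rfl⟩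
    · refine MvPolynomial.algHom_ext fun t => ?_
      rw [← alphaTree_V]
      exact congrFun (overMul_vtx_injective h) (V t)
    · rintro _ ⟨f, g, -, h, rfl⟩
      obtain ⟨h1, h2⟩ := (overMul_right_inv_iff _ _).1 h
      refine ⟨MvPolynomial.aeval f, Set.mem_univ _, ?_⟩
      dsimp only [pointSeries]
      congr 1
      ext t
      induction t with
      | nil => rw [alphaTree_nil, map_one, h1]
      | node x a r ih =>
        cases x
        rw [alphaTree_node, map_mul, ih, MvPolynomial.aeval_X, h2]
  map_conv A _ _ χ ψ := by
    -- The law is inherited from `Grho`: precomposition with `R` preserves both the point series and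
    -- convolution.
    rw [← pointSeries_comp_R, ← pointSeries_comp_R, ← pointSeries_comp_R, ← convMul_comp_R,
      pointSeries_rho_conv]
  map_counit A _ _ := by
    rw [← pointSeries_comp_R, AlgHom.comp_assoc, alphaEps_comp_R, rho_isRepresentedBy.map_counit]
  natural A B _ _ _ _ := pointSeries_natural alphaTree

theorem Galpha_subset_Grho (A : Type u) [CommRing A] [Algebra ℚ A] : Galpha A ⊆ Grho A := by
  rintro _ ⟨f, g, -, h, rfl⟩
  exact ⟨g, ((overMul_right_inv_iff _ _).1 h).1, rfl⟩

/-! ### Gradings -/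

section TensorGrading

variable {H : Type} [Ring H] [Algebra ℚ H]

/-- The component of degree `n` of the tensor square of a graded algebra. -/
noncomputable def tensorGr (gr : ℕ → Submodule ℚ H) (n : ℕ) : Submodule ℚ (H ⊗[ℚ] H) :=
  ⨆ p : {p : ℕ × ℕ // p.1 + p.2 = n},
    LinearMap.range (TensorProduct.map (gr p.1.1).subtype (gr p.1.2).subtype)

theorem tmul_mem_tensorGr {gr : ℕ → Submodule ℚ H} {i j n : ℕ} (h : i + j = n) {x y : H}
    (hx : x ∈ gr i) (hy : y ∈ gr j) : x ⊗ₜ y ∈ tensorGr gr n :=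
  Submodule.mem_iSup_of_mem ⟨(i, j), h⟩ ⟨⟨x, hx⟩ ⊗ₜ ⟨y, hy⟩, rfl⟩

theorem one_mem_tensorGr {gr : ℕ → Submodule ℚ H} (h : 1 ∈ gr 0) : 1 ∈ tensorGr gr 0 := by
  rw [Algebra.TensorProduct.one_def]
  exact tmul_mem_tensorGr (zero_add 0) h h

theorem tensorGr_induction {gr : ℕ → Submodule ℚ H} {n : ℕ} {p : H ⊗[ℚ] H → Prop}
    (tmul : ∀ i j, i + j = n → ∀ x ∈ gr i, ∀ y ∈ gr j, p (x ⊗ₜ y)) (zero : p 0)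
    (add : ∀ x y, p x → p y → p (x + y)) {z : H ⊗[ℚ] H} (hz : z ∈ tensorGr gr n) : p z := by
  refine Submodule.iSup_induction _ (motive := p) hz ?_ zero add
  rintro k _ ⟨w, rfl⟩
  induction w with
  | zero => simpa using zero
  | tmul a b => exact tmul _ _ k.2 a a.2 b b.2
  | add a b ha hb => rw [map_add]; exact add _ _ ha hb

theorem mul_mem_tensorGr {gr : ℕ → Submodule ℚ H}
    (hmul : ∀ m n, ∀ x ∈ gr m, ∀ y ∈ gr n, x * y ∈ gr (m + n)) {m n : ℕ} {z w : H ⊗[ℚ] H}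
    (hz : z ∈ tensorGr gr m) (hw : w ∈ tensorGr gr n) : z * w ∈ tensorGr gr (m + n) := by
  refine tensorGr_induction (p := fun z => z * w ∈ tensorGr gr (m + n)) ?_ ?_ ?_ hz
  · intro i j hij x hx y hy
    refine tensorGr_induction (p := fun w => x ⊗ₜ y * w ∈ tensorGr gr (m + n)) ?_ ?_ ?_ hw
    · intro i' j' hij' x' hx' y' hy'
      rw [Algebra.TensorProduct.tmul_mul_tmul]
      exact tmul_mem_tensorGr (by omega) (hmul _ _ _ hx _ hx') (hmul _ _ _ hy _ hy')
    · rw [mul_zero]; exact zero_mem _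
    · intro a b ha hb; rw [mul_add]; exact add_mem ha hb
  · rw [zero_mul]; exact zero_mem _
  · intro a b ha hb; rw [add_mul]; exact add_mem ha hb

end TensorGrading

/-! ### Weight gradings on polynomial algebras -/

section MvPolynomialGrading

open MvPolynomial

variable {σ : Type} {w : σ → ℕ}

theorem map_monomial_mem_of_map_X_mem {B : Type*} [Ring B] [Algebra ℚ B]
    {Δ : MvPolynomial σ ℚ →ₐ[ℚ] B} {gr : ℕ → Submodule ℚ B} (hone : 1 ∈ gr 0)
    (hmul : ∀ m n, ∀ x ∈ gr m, ∀ y ∈ gr n, x * y ∈ gr (m + n))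
    (hΔ : ∀ i, Δ (X i) ∈ gr (w i)) (d : σ →₀ ℕ) :
    Δ (monomial d 1) ∈ gr (Finsupp.weight w d) := by
  induction d using Finsupp.induction_linear with
  | zero => rw [monomial_zero', map_one, map_one, map_zero]; exact hone
  | add a b ha hb =>
    rw [← one_mul (1 : ℚ), ← monomial_mul, map_mul, map_add]
    exact hmul _ _ _ ha _ hb
  | single i n =>
    induction n with
    | zero => rw [Finsupp.single_zero, monomial_zero', map_one, map_one, map_zero]; exact hone
    | succ n ih =>
      rw [Finsupp.single_add, ← one_mul (1 : ℚ), ← monomial_mul, map_mul, map_add]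
      refine hmul _ _ _ ih _ ?_
      rw [Finsupp.weight_single, one_smul]
      exact hΔ i

theorem map_mem_of_map_X_mem {B : Type*} [Ring B] [Algebra ℚ B]
    {Δ : MvPolynomial σ ℚ →ₐ[ℚ] B} {gr : ℕ → Submodule ℚ B} (hone : 1 ∈ gr 0)
    (hmul : ∀ m n, ∀ x ∈ gr m, ∀ y ∈ gr n, x * y ∈ gr (m + n))
    (hΔ : ∀ i, Δ (X i) ∈ gr (w i)) {n : ℕ} {x : MvPolynomial σ ℚ}
    (hx : x.IsWeightedHomogeneous w n) : Δ x ∈ gr n := by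
  induction hx using IsWeightedHomogeneous.induction_on with
  | zero => rw [map_zero]; exact zero_mem _
  | add p q _ _ hp hq => rw [map_add]; exact add_mem hp hq
  | monomial d r hr =>
    rw [← mul_one r, ← smul_eq_mul, ← smul_monomial, map_smul, ← hr]
    exact Submodule.smul_mem _ _ (map_monomial_mem_of_map_X_mem hone hmul hΔ d)

theorem weightedHomogeneousSubmodule_zero (hw : ∀ i, w i ≠ 0) :
    weightedHomogeneousSubmodule ℚ w 0 = Submodule.span ℚ {1} := by
  ext x
  rw [Submodule.mem_span_singleton]
  constructor
  · intro hx
    refine ⟨x.coeff 0, ?_⟩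
    have h := weightedHomogeneousComponent_zero (w := w) x hw
    rw [IsWeightedHomogeneous.weightedHomogeneousComponent_same hx] at h
    rw [← C_mul', mul_one, ← h]
  · rintro ⟨c, rfl⟩
    exact Submodule.smul_mem _ _ (isWeightedHomogeneous_one ℚ w)

theorem weightedHomogeneousSubmodule_isInternal (w : σ → ℕ) :
    DirectSum.IsInternal (weightedHomogeneousSubmodule ℚ w) := by
  classical
  let _ := weightedDecomposition ℚ w
  exact DirectSum.Decomposition.isInternal _

/-- An algebra morphism that respects degrees on the variables respects them everywhere, and nonzero
weights leave only the constants in degree `0`. -/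
theorem isGradedConnected_mvPolynomial
    {Δ : MvPolynomial σ ℚ →ₐ[ℚ] MvPolynomial σ ℚ ⊗[ℚ] MvPolynomial σ ℚ}
    {ε : MvPolynomial σ ℚ →ₐ[ℚ] ℚ} (hw : ∀ i, w i ≠ 0)
    (hΔ : ∀ i, Δ (X i) ∈ tensorGr (weightedHomogeneousSubmodule ℚ w) (w i))
    (hε : ∀ i, ε (X i) = 0) : IsGradedConnected Δ ε (weightedHomogeneousSubmodule ℚ w) where
  decomposition := weightedHomogeneousSubmodule_isInternal w
  mul_mem _ _ _ hx _ hy := IsWeightedHomogeneous.mul hx hy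
  comul_mem n x hx := map_mem_of_map_X_mem
    (one_mem_tensorGr (isWeightedHomogeneous_one ℚ w))
    (fun _ _ _ hx _ hy => mul_mem_tensorGr (fun _ _ _ h _ h' => IsWeightedHomogeneous.mul h h') hx hy)
    hΔ hx
  counit_eq_zero n hn x hx := by
    have hε' : ε = aeval fun _ => 0 := algHom_ext fun i => by rw [hε, aeval_X]
    have h0 : x.coeff 0 = 0 := IsWeightedHomogeneous.coeff_eq_zero hx 0 (by simpa using hn.symm)
    rw [hε', aeval_zero', constantCoeff_eq, h0]
    rfl
  connected := weightedHomogeneousSubmodule_zero hw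

end MvPolynomialGrading

theorem numNodes_mul (s t : Y) : (s * t).numNodes = s.numNodes + t.numNodes :=
  numNodes_graftOver s t

theorem numNodes_list_prod (L : List Y) : L.prod.numNodes = (L.map BinaryTree.numNodes).sum := by
  induction L with
  | nil => rfl
  | cons a L ih => rw [List.prod_cons, numNodes_mul, ih, List.map_cons, List.sum_cons]

/-- Each `s_i / vtx` has one vertex more than `s_i`; these `|t|` extra vertices account for the
order of `t`. This is the homogeneity of the coproducts. -/
theorem numNodes_eq_of_mem_rhoDecomp {u : Y} {p : Y × List Y × Y} (hp : p ∈ rhoDecomp u) :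
    p.1.numNodes + ((p.2.1.map BinaryTree.numNodes).sum + p.2.2.numNodes) = u.numNodes := by
  obtain ⟨-, h1, h2⟩ := mem_rhoDecomp.1 hp
  have h3 := congrArg BinaryTree.numNodes h2
  rw [numNodes_graftOver, numNodes_treeProd _ _ (by simpa using h1)] at h3
  have h4 : ((p.2.1.map fun s => graftOver s vtx).map BinaryTree.numNodes).sum =
      (p.2.1.map BinaryTree.numNodes).sum + p.2.1.length := by
    rw [List.map_map]
    generalize p.2.1 = L
    induction L with
    | nil => rfl
    | cons a L ih =>
      simp only [List.map_cons, List.sum_cons, List.length_cons, ih, Function.comp_apply,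
        numNodes_graftOver]
      simp only [vtx, BinaryTree.numNodes]
      omega
  omega

theorem nc_isGradedConnected : IsGradedConnected ncDelta ncEps (orderGrading ncTree) := by
  have htree (t : Y) : ncTree t ∈ orderGrading ncTree t.numNodes :=
    Submodule.subset_span ⟨t, rfl, rfl⟩
  have hmul (m n : ℕ) (x : Hnc) (hx : x ∈ orderGrading ncTree m) (y : Hnc)
      (hy : y ∈ orderGrading ncTree n) : x * y ∈ orderGrading ncTree (m + n) := by
    refine (Submodule.mul_le (P := orderGrading ncTree (m + n))).1 ?_ x hx y hy
    rw [orderGrading, orderGrading, Submodule.span_mul_span, Submodule.span_le]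
    rintro _ ⟨_, ⟨s, rfl, rfl⟩, _, ⟨t, rfl, rfl⟩, rfl⟩
    dsimp only
    rw [← ncTree_mul, ← numNodes_mul]
    exact htree _
  refine ⟨?_, hmul, fun n x hx => ?_, fun n hn x hx => ?_, ?_⟩
  · have hli : LinearIndependent ℚ ncTree := (MonoidAlgebra.basis Y ℚ).linearIndependent
    refine DirectSum.isInternal_submodule_of_iSupIndep_of_iSup_eq_top (fun n => ?_) ?_
    · have : (⨆ (j : ℕ) (_ : j ≠ n), orderGrading ncTree j) ≤
          Submodule.span ℚ (ncTree '' {t | t.numNodes ≠ n}) :=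
        iSup₂_le fun j hj => Submodule.span_mono (Set.image_mono fun t ht => by
          change t.numNodes = j at ht
          change t.numNodes ≠ n
          rwa [ht])
      -- The trees of order `n` and the remaining trees are disjoint parts of a basis.
      refine Disjoint.mono_right this (hli.disjoint_span_image ?_)
      exact Set.disjoint_left.2 fun t h h' => h' h
    · rw [eq_top_iff]
      intro x _
      induction x using Hnc_induction with
      | tree t => exact Submodule.mem_iSup_of_mem _ (htree t)
      | add x y hx hy => exact add_mem (hx trivial) (hy trivial)
      | smul c x hx => exact Submodule.smul_mem _ _ (hx trivial)
  · refine (Submodule.span_le (p := (tensorGr (orderGrading ncTree) n).comap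
      ncDelta.toLinearMap)).2 ?_ hx
    rintro _ ⟨u, rfl, rfl⟩
    change ncDelta (ncTree u) ∈ tensorGr (orderGrading ncTree) u.numNodes
    rw [ncDelta_ncTree_eq_sum]
    refine add_mem (tmul_mem_tensorGr (zero_add _) (htree .nil) (htree u))
      (Submodule.sum_mem _ fun p hp => tmul_mem_tensorGr (numNodes_eq_of_mem_rhoDecomp hp) (htree _) ?_)
    rw [← ncTree_list_prod, ← numNodes_list_prod]
    exact hmul _ _ _ (htree _) _ (htree _)
  · refine (Submodule.span_le (p := LinearMap.ker ncEps.toLinearMap)).2 ?_ hx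
    rintro _ ⟨u, rfl, rfl⟩
    cases u with
    | nil => exact absurd rfl hn
    | node x l r => exact ncEps_ncTree_node l r
  · have : {t : Y | t.numNodes = 0} = {.nil} := by
      ext t; cases t <;> simp
    rw [orderGrading, this, Set.image_singleton, ncTree_nil]

/-- The variable indexed by `t` stands for `V(t)`, whence the weight `|t| + 1`. -/
theorem alphaTree_isWeightedHomogeneous (t : Y) :
    (alphaTree t).IsWeightedHomogeneous (fun t : Y => t.numNodes + 1) t.numNodes := by
  induction t with
  | nil => exact MvPolynomial.isWeightedHomogeneous_one ℚ _
  | node x l r hl _ =>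
    cases x
    rw [alphaTree_node]
    exact hl.mul (MvPolynomial.isWeightedHomogeneous_X ℚ _ r)

theorem exists_alphaTree_eq_monomial (d : Y →₀ ℕ) : ∃ t : Y,
    alphaTree t = MvPolynomial.monomial d 1 ∧
      t.numNodes = Finsupp.weight (fun t : Y => t.numNodes + 1) d := by
  suffices h : ∃ t : Y, alphaTree t = MvPolynomial.monomial d 1 by
    obtain ⟨t, ht⟩ := h
    refine ⟨t, ht, ?_⟩
    have h1 := alphaTree_isWeightedHomogeneous t
    rw [ht] at h1
    -- A nonzero polynomial has at most one weight, which determines the order of `t`.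
    exact MvPolynomial.IsWeightedHomogeneous.inj_right (by simp) h1
      (MvPolynomial.isWeightedHomogeneous_monomial _ d 1 rfl)
  induction d using Finsupp.induction_linear with
  | zero => exact ⟨.nil, rfl⟩
  | add a b ha hb =>
    obtain ⟨s, hs⟩ := ha
    obtain ⟨t, ht⟩ := hb
    exact ⟨s * t, by rw [alphaTree_mul, hs, ht, MvPolynomial.monomial_mul, one_mul]⟩
  | single i n =>
    refine ⟨V i ^ n, ?_⟩
    rw [← MvPolynomial.X_pow_eq_monomial, ← alphaTree_V]
    exact map_pow alphaTreeHom _ _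

theorem orderGrading_alphaTree : orderGrading alphaTree =
    MvPolynomial.weightedHomogeneousSubmodule ℚ fun t : Y => t.numNodes + 1 := by
  ext1 n
  apply le_antisymm
  · refine Submodule.span_le.2 ?_
    rintro _ ⟨t, rfl, rfl⟩
    exact alphaTree_isWeightedHomogeneous t
  · intro x hx
    induction (show x.IsWeightedHomogeneous _ n from hx)
      using MvPolynomial.IsWeightedHomogeneous.induction_on with
    | zero => exact zero_mem _
    | add p q _ _ hp hq => exact add_mem (hp ‹_›) (hq ‹_›)
    | monomial d r hr =>
      obtain ⟨t, h1, h2⟩ := exists_alphaTree_eq_monomial d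
      rw [← mul_one r, ← smul_eq_mul, ← MvPolynomial.smul_monomial, ← h1]
      exact Submodule.smul_mem _ _ (Submodule.subset_span ⟨t, h2.trans hr, rfl⟩)

theorem alpha_isGradedConnected :
    IsGradedConnected alphaDelta alphaEps (orderGrading alphaTree) := by
  rw [orderGrading_alphaTree]
  refine isGradedConnected_mvPolynomial (fun t => by omega) (fun t => ?_) fun t => by
    rw [alphaEps, MvPolynomial.aeval_X]
  have h (s : Y) := alphaTree_isWeightedHomogeneous s
  have ht : (V t).numNodes = t.numNodes + 1 := by simp [V, vtx, graftUnder]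
  rw [← alphaTree_V, alphaDelta_alphaTree, ← ht]
  refine add_mem (tmul_mem_tensorGr (zero_add _) (h .nil) (h _))
    (Submodule.sum_mem _ fun p hp => tmul_mem_tensorGr (numNodes_eq_of_mem_rhoDecomp hp) (h _) ?_)
  rw [← alphaTree_list_prod, ← numNodes_list_prod]
  exact (h _).mul (h _)

theorem rho_isGradedConnected : IsGradedConnected rhoDelta rhoEps
    (MvPolynomial.weightedHomogeneousSubmodule ℚ fun t : {t : Y // t ≠ .nil} => t.1.numNodes) := by
  refine isGradedConnected_mvPolynomial (fun t => ?_) (fun t => ?_) fun t => by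
    rw [rhoEps, MvPolynomial.aeval_X]
  · obtain ⟨t, ht⟩ := t
    cases t with
    | nil => exact absurd rfl ht
    | node => simp
  · have h (s : Y) : (rhoTree s).IsWeightedHomogeneous
        (fun t : {t : Y // t ≠ .nil} => t.1.numNodes) s.numNodes := by
      by_cases hs : s = .nil
      · rw [hs, rhoTree_nil]; exact MvPolynomial.isWeightedHomogeneous_one ℚ _
      · rw [rhoTree_of_ne hs]
        exact MvPolynomial.isWeightedHomogeneous_X ℚ (fun t : {t : Y // t ≠ .nil} => t.1.numNodes)
          ⟨s, hs⟩
    have hL (L : List Y) : ((L.map rhoTree).prod).IsWeightedHomogeneous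
        (fun t : {t : Y // t ≠ .nil} => t.1.numNodes) (L.map BinaryTree.numNodes).sum := by
      induction L with
      | nil => exact MvPolynomial.isWeightedHomogeneous_one ℚ _
      | cons a L ih =>
        simp only [List.map_cons, List.prod_cons, List.sum_cons]
        exact (h a).mul ih
    rw [rhoDelta, MvPolynomial.aeval_X]
    exact add_mem (tmul_mem_tensorGr (zero_add _) (MvPolynomial.isWeightedHomogeneous_one ℚ _) (h _))
      (Submodule.sum_mem _ fun p hp => tmul_mem_tensorGr (numNodes_eq_of_mem_rhoDecomp hp) (h _)
        ((hL _).mul (h _)))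

/-! ### The free algebra and its abelian quotient -/

/-- The monoid of trees is free on the trees `V t`. -/
noncomputable def freeMonoidEquiv : FreeMonoid Y ≃* Y :=
  MulEquiv.ofBijective (FreeMonoid.lift V) <| by
    -- The inverse lists the right subtrees met along the left-most branch.
    have hinv : ∃ g : Y → FreeMonoid Y, g 1 = 1 ∧ ∀ l r, g (l * V r) = g l * .of r :=
      ⟨BinaryTree.rec 1 fun _ _ r cl _ => cl * FreeMonoid.of r, rfl, fun _ _ => rfl⟩
    obtain ⟨g, h1, h2⟩ := hinv
    have hg (s t : Y) : g (s * t) = g s * g t := by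
      induction t with
      | nil =>
        change g (s * 1) = g s * g 1
        rw [mul_one, h1, mul_one]
      | node x l r hl _ =>
        cases x
        rw [node_eq_mul, ← mul_assoc, h2, h2, hl, mul_assoc]
    refine ⟨Function.LeftInverse.injective (g := g) fun x => ?_, fun t => ?_⟩
    · induction x using FreeMonoid.inductionOn' with
      | one => rw [map_one, h1]
      | of_mul a x hx =>
        rw [map_mul, hg, hx, FreeMonoid.lift_eval_of, ← one_mul (V a), h2, h1, one_mul]
    · induction t with
      | nil => exact ⟨1, map_one _⟩
      | node x l r hl _ =>
        cases x
        obtain ⟨y, rfl⟩ := hl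
        exact ⟨y * .of r, by rw [map_mul, FreeMonoid.lift_eval_of]; rfl⟩

theorem freeAlgebra_lift_bijective :
    Function.Bijective (FreeAlgebra.lift ℚ fun t : Y => ncTree (V t)) := by
  let e : FreeAlgebra ℚ Y ≃ₐ[ℚ] Hnc :=
    FreeAlgebra.equivMonoidAlgebraFreeMonoid.trans (MonoidAlgebra.domCongr ℚ ℚ freeMonoidEquiv)
  have h : FreeAlgebra.lift ℚ (fun t : Y => ncTree (V t)) = e.toAlgHom := by
    ext1
    ext1 t
    simp [e, FreeAlgebra.equivMonoidAlgebraFreeMonoid, ncTree, freeMonoidEquiv]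
  rw [h]
  exact e.bijective

/-- The quotient of `ℚY` by the commutators is commutative, so its projection factors through
`abProj` by the universal property of the polynomial algebra; this bounds the kernel. The other
inclusion is the commutativity of `Halpha`. -/
theorem ker_abProj : TwoSidedIdeal.ker abProj =
    TwoSidedIdeal.span {z | ∃ x y : Hnc, z = x * y - y * x} := by
  apply le_antisymm
  · set I := TwoSidedIdeal.span {z | ∃ x y : Hnc, z = x * y - y * x} with hI
    have hmk (x : Hnc) : I.ringCon.mkₐ (α := ℚ) x = 0 ↔ x ∈ I := by
      have h := TwoSidedIdeal.mem_ker (f := I.ringCon.mk') (x := x)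
      rw [TwoSidedIdeal.ker_ringCon_mk'] at h
      exact h.symm
    have hcomm (a b : I.ringCon.Quotient) : a * b = b * a := by
      obtain ⟨x, rfl⟩ := I.ringCon.mkₐ_surjective (α := ℚ) a
      obtain ⟨y, rfl⟩ := I.ringCon.mkₐ_surjective (α := ℚ) b
      rw [← map_mul, ← map_mul, ← sub_eq_zero, ← map_sub, hmk]
      exact TwoSidedIdeal.subset_span ⟨x, y, rfl⟩
    let _ : CommRing I.ringCon.Quotient :=
      { (inferInstance : Ring I.ringCon.Quotient) with mul_comm := hcomm }
    let g : Halpha →ₐ[ℚ] I.ringCon.Quotient :=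
      MvPolynomial.aeval fun t => I.ringCon.mkₐ (α := ℚ) (ncTree (V t))
    have hg : g.comp abProj = I.ringCon.mkₐ (α := ℚ) := by
      refine Hnc_algHom_ext fun t => ?_
      rw [AlgHom.comp_apply, abProj_ncTree, alphaTree_V, MvPolynomial.aeval_X]
    intro x hx
    rw [TwoSidedIdeal.mem_ker] at hx
    rw [← hmk, ← hg, AlgHom.comp_apply, hx, map_zero]
  · rw [TwoSidedIdeal.span_le]
    rintro _ ⟨x, y, rfl⟩
    rw [SetLike.mem_coe, TwoSidedIdeal.mem_ker, map_sub, map_mul, map_mul, mul_comm, sub_self]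

end QEDCharge

theorem mainTheorem2 :
    -- the charge algebra is a connected graded Hopf algebra
    (QEDCharge.IsHopf QEDCharge.alphaDelta QEDCharge.alphaEps ∧
      QEDCharge.IsGradedConnected QEDCharge.alphaDelta QEDCharge.alphaEps
        (QEDCharge.orderGrading QEDCharge.alphaTree)) ∧
    -- it represents the group functor `Galpha`
    (QEDCharge.IsGroupFunctor.{u} QEDCharge.Galpha ∧
      QEDCharge.IsRepresentedBy.{u} QEDCharge.alphaDelta QEDCharge.alphaEps
        QEDCharge.alphaTree QEDCharge.Galpha) ∧
    -- the Hopf algebra `Hrho` represents the group functor `Grho`, which contains `Galpha`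
    (QEDCharge.IsHopf QEDCharge.rhoDelta QEDCharge.rhoEps ∧
      QEDCharge.IsGroupFunctor.{u} QEDCharge.Grho ∧
      QEDCharge.IsRepresentedBy.{u} QEDCharge.rhoDelta QEDCharge.rhoEps
        QEDCharge.rhoTree QEDCharge.Grho ∧
      ∀ (A : Type u) [CommRing A] [Algebra ℚ A], QEDCharge.Galpha A ⊆ QEDCharge.Grho A) ∧
    -- the projection `R` is a surjective morphism of Hopf algebras, dual to the inclusion
    (Function.Surjective QEDCharge.R ∧
      (Algebra.TensorProduct.map QEDCharge.R QEDCharge.R).comp QEDCharge.rhoDelta =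
        QEDCharge.alphaDelta.comp QEDCharge.R ∧
      QEDCharge.alphaEps.comp QEDCharge.R = QEDCharge.rhoEps ∧
      ∀ (A : Type u) [CommRing A] [Algebra ℚ A] (χ : QEDCharge.Halpha →ₐ[ℚ] A),
        QEDCharge.pointSeries QEDCharge.rhoTree (χ.comp QEDCharge.R) =
          QEDCharge.pointSeries QEDCharge.alphaTree χ) ∧
    -- the non-commutative lift: free on the `V(t)`, a connected graded Hopf algebra,
    -- with abelian quotient the charge Hopf algebra
    (Function.Bijective
        (FreeAlgebra.lift ℚ fun t : QEDCharge.Y => QEDCharge.ncTree (QEDCharge.V t)) ∧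
      QEDCharge.IsHopf QEDCharge.ncDelta QEDCharge.ncEps ∧
      QEDCharge.IsGradedConnected QEDCharge.ncDelta QEDCharge.ncEps
        (QEDCharge.orderGrading QEDCharge.ncTree) ∧
      Function.Surjective QEDCharge.abProj ∧
      TwoSidedIdeal.ker QEDCharge.abProj =
        TwoSidedIdeal.span {z | ∃ x y : QEDCharge.Hnc, z = x * y - y * x} ∧
      (Algebra.TensorProduct.map QEDCharge.abProj QEDCharge.abProj).comp QEDCharge.ncDelta =
        QEDCharge.alphaDelta.comp QEDCharge.abProj ∧
      QEDCharge.alphaEps.comp QEDCharge.abProj = QEDCharge.ncEps) ∧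
    -- the non-recursive formula, on the non-commutative lift and on the charge algebra
    (∀ v : QEDCharge.Y,
      QEDCharge.ncDelta (QEDCharge.ncTree (QEDCharge.V v)) =
        1 ⊗ₜ[ℚ] QEDCharge.ncTree (QEDCharge.V v) +
          ∑ p ∈ QEDCharge.alphaDecomp v,
            QEDCharge.ncTree (QEDCharge.V p.1) ⊗ₜ[ℚ] (p.2.map QEDCharge.ncTree).prod) ∧
    (∀ v : QEDCharge.Y,
      QEDCharge.alphaDelta (QEDCharge.alphaTree (QEDCharge.V v)) =
        1 ⊗ₜ[ℚ] QEDCharge.alphaTree (QEDCharge.V v) +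
          ∑ p ∈ QEDCharge.alphaDecomp v,
            QEDCharge.alphaTree (QEDCharge.V p.1) ⊗ₜ[ℚ] (p.2.map QEDCharge.alphaTree).prod) := by
  open QEDCharge in
  exact ⟨⟨isBialg_alpha.isHopf alpha_isGradedConnected, alpha_isGradedConnected⟩,
    ⟨isBialg_alpha.isGroupFunctor alpha_isGradedConnected alpha_isRepresentedBy,
      alpha_isRepresentedBy⟩,
    ⟨isBialg_rho.isHopf rho_isGradedConnected,
      isBialg_rho.isGroupFunctor rho_isGradedConnected rho_isRepresentedBy,
      rho_isRepresentedBy, Galpha_subset_Grho⟩,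
    ⟨R_surjective, map_R_comp_rhoDelta, alphaEps_comp_R, fun _ _ _ χ => pointSeries_comp_R χ⟩,
    ⟨freeAlgebra_lift_bijective, isBialg_nc.isHopf nc_isGradedConnected, nc_isGradedConnected,
      abProj_surjective, ker_abProj, map_abProj_comp_ncDelta, alphaEps_comp_abProj⟩,
    ncDelta_V_eq_sum, alphaDelta_V_eq_sum⟩
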